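/- Let $x\in S$ be a germ of a smooth complex surface and let $C\subset S$ be the germ of an effective (possibly reducible or non-reduced) curve, $x\in C$. Let $N\ge 1$ and let $$S_N\xrightarrow{\varphi_{N,N-1}} S_{N-1}\to\cdots\to S_1\xrightarrow{\varphi_{1,0}} S_0=S$$ be a sequence of blow-ups, where $\varphi_{i,i-1}$ blows up a point $x_{i-1}\in S_{i-1}$ with exceptional line $E_i=\varphi_{i,i-1}^{-1}(x_{i-1})\subset S_i$, where $x_0=x$ and $x_i\in E_i$ for $1\le i\le N-1$. Let $\varphi\colon \widetilde S=S_N\to S$ be the composition, let $C^i$ be the strict transform of $C$ on $S_i$ (with $C^0=C$), and put $\mu_i=\mathrm{mult}_{x_{i-1}}C^{i-1}$ for $1\le i\le N$. Let $n\ge 1$ be an integer and suppose that some exceptional divisor $E\subset\widetilde S$ of $\varphi$, that is, (the strict transform of) one of $E_1,\dots,E_N$, realizes a non-log-canonical singularity of the pair $(S,\frac1n C)$ at $x$: $$\mathrm{ord}_E\,\varphi^*C>n\,(a_E+1),$$ where $a_E$ is the discrepancy of $E$, i.e. the coefficient of $E$ in $K_{\widetilde S}-\varphi^*K_S$. Then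 either $\mu_1>2n$, or $N\ge 2$ and $\mu_1+\mu_2>2n$. -/

import Mathlib

open IsLocalRing
open scoped KaehlerDifferential

namespace SurfaceGerm

universe u

variable {K : Type u} [Field K]

/-- `O ⊆ K` is the local ring `𝒪_{S,x}` of a germ `x ∈ S` of a smooth complex surface and `K` is
its fraction field: `O` is a regular local ring of dimension two that contains the constants and
has residue field `ℂ`. -/
structure IsSmoothSurfaceGerm [Algebra ℂ K] (O : LocalSubring K) : Prop where
  isFractionRing : IsFractionRing O.toSubring K
  isRegular : IsRegularLocalRing O.toSubring
  dim_eq_two : ringKrullDim O.toSubring = 2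
  const_mem : ∀ c : ℂ, algebraMap ℂ K c ∈ O.toSubring
  residue : ∀ a : O.toSubring, ∃ c : ℂ,
    a - ⟨algebraMap ℂ K c, const_mem c⟩ ∈ maximalIdeal O.toSubring

/-- For subrings `A ⊆ B` of `K` and an ideal `I` of `A`, the extended ideal `I B`. If `I` defines a
curve on a model with local ring `A`, this is the ideal of its pull-back to a model over it with
local ring `B`. -/
def extend (A B : Subring K) (I : Ideal A) : Ideal B :=
  Ideal.span {b : B | ∃ a ∈ I, (a : K) = (b : K)}

/-- The affine chart `A[𝔪/t]` (for `0 ≠ t ∈ 𝔪`) of the blow-up `Proj ⨁ 𝔪ᵏ` of the closed point of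
`Spec A`, as a subring of the field of fractions. -/
def chart (A : LocalSubring K) (t : K) : Subring K :=
  Subring.closure
    ((A.toSubring : Set K) ∪ {z : K | ∃ b ∈ maximalIdeal A.toSubring, z = (b : K) / t})

/-- The ideal of the exceptional divisor in the chart `A[𝔪/t]`: the extension of the maximal ideal
of `A`. -/
def exceptionalIdeal (A : LocalSubring K) (t : K) : Ideal (chart A t) :=
  extend A.toSubring (chart A t) (maximalIdeal A.toSubring)

/-- `B` is the local ring of a closed point, lying on the exceptional divisor, of the blow-up of
the closed point of `Spec A`. -/
def IsPointOfBlowUp (A B : LocalSubring K) : Prop :=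
  ∃ t ∈ maximalIdeal A.toSubring, t ≠ 0 ∧
    ∃ (P : Ideal (chart A (t : K))) (_ : P.IsMaximal),
      exceptionalIdeal A (t : K) ≤ P ∧ B = LocalSubring.ofPrime (chart A (t : K)) P

/-- `V` is the local ring, at the generic point of the exceptional divisor `E`, of the blow-up of
the closed point of `Spec A`; that is, the local ring `𝒪_E` of the prime divisor `E`. -/
def IsExceptionalDivisor (A V : LocalSubring K) : Prop :=
  ∃ t ∈ maximalIdeal A.toSubring, t ≠ 0 ∧
    ∃ (P : Ideal (chart A (t : K))) (_ : P.IsPrime),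
      P ∈ (exceptionalIdeal A (t : K)).minimalPrimes ∧
        V = LocalSubring.ofPrime (chart A (t : K)) P

/-- `x 0, …, x (N - 1)` are the local rings of the centres `x_0, …, x_{N-1}` of a sequence of `N`
blow-ups of points lying one over another: `x_{i+1}` is a closed point of the exceptional divisor
of the blow-up of `x_i`. (The values `x i` with `i ≥ N` play no role.) -/
def IsBlowUpChain (N : ℕ) (x : ℕ → LocalSubring K) : Prop :=
  ∀ i, i + 1 < N → IsPointOfBlowUp (x i) (x (i + 1))

theorem le_chart (A : LocalSubring K) (t : K) : A.toSubring ≤ chart A t :=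
  fun _ ha => Subring.subset_closure (Or.inl ha)

theorem IsPointOfBlowUp.le {A B : LocalSubring K} (h : IsPointOfBlowUp A B) :
    A.toSubring ≤ B.toSubring := by
  obtain ⟨t, _, _, P, hP, _, rfl⟩ := h
  have := hP.isPrime
  exact (le_chart A t).trans (LocalSubring.le_ofPrime _ P)

theorem IsExceptionalDivisor.le {A V : LocalSubring K} (h : IsExceptionalDivisor A V) :
    A.toSubring ≤ V.toSubring := by
  obtain ⟨t, _, _, P, _, _, rfl⟩ := h
  exact (le_chart A t).trans (LocalSubring.le_ofPrime _ P)

theorem IsBlowUpChain.le {N : ℕ} {x : ℕ → LocalSubring K} (h : IsBlowUpChain N x) :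
    ∀ i, i < N → (x 0).toSubring ≤ (x i).toSubring
  | 0, _ => le_rfl
  | i + 1, hi => (h.le i (Nat.lt_of_succ_lt hi)).trans (h i hi).le

/-- The local ring of the surface `S` is contained in the local ring of each exceptional divisor of
the chain of blow-ups. -/
theorem IsBlowUpChain.le_exceptional {N : ℕ} {x : ℕ → LocalSubring K} (h : IsBlowUpChain N x)
    {i : ℕ} (hi : i < N) {V : LocalSubring K} (hV : IsExceptionalDivisor (x i) V) :
    (x 0).toSubring ≤ V.toSubring :=
  (h.le i hi).trans hV.le

/-- The order of an ideal in a local ring: the largest `k` with `I ⊆ 𝔪ᵏ`. At a closed point of a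
smooth surface this is the multiplicity at that point of the curve defined by `I`; at the generic
point of a prime divisor `E` it is the order of vanishing of `I` along `E`. -/
noncomputable def order (A : LocalSubring K) (I : Ideal A.toSubring) : ℕ∞ :=
  ⨆ (k : ℕ) (_ : I ≤ maximalIdeal A.toSubring ^ k), (k : ℕ∞)

/-- The strict transform, at a point with local ring `B` of the blow-up of the closed point of
`Spec A`, of the curve with ideal `I`: the ideal `⋃ₖ (I B : (𝔪 B)ᵏ)` of the closure of the
pull-back of the curve outside the exceptional divisor. -/
def strictTransform (A B : LocalSubring K) (I : Ideal A.toSubring) : Ideal B.toSubring :=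
  ⨆ k : ℕ, (extend A.toSubring B.toSubring I).colon
    ((extend A.toSubring B.toSubring (maximalIdeal A.toSubring) ^ k : Ideal B.toSubring) :
      Set B.toSubring)

/-- The ideal at `x_i` of the strict transform `C^i` of the curve `C`. -/
def strictTransformAt (x : ℕ → LocalSubring K) (C : Ideal (x 0).toSubring) :
    (i : ℕ) → Ideal (x i).toSubring
  | 0 => C
  | i + 1 => strictTransform (x i) (x (i + 1)) (strictTransformAt x C i)

/-- `μ_i = mult_{x_{i-1}} C^{i-1}`, for `i ≥ 1`. -/
noncomputable def mult (x : ℕ → LocalSubring K) (C : Ideal (x 0).toSubring) (i : ℕ) : ℕ∞ :=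
  order (x (i - 1)) (strictTransformAt x C (i - 1))

/-- The order `ν_E(C) = ord_E φ^* C` of the pull-back of the curve with ideal `C` along the prime
divisor with local ring `V`. -/
noncomputable def orderAlong (O V : LocalSubring K) (C : Ideal O.toSubring) : ℕ∞ :=
  order V (extend O.toSubring V.toSubring C)

/-- The discrepancy `a_E` of the prime divisor `E` with local ring `V` over the smooth surface
germ with local ring `O`, that is, the coefficient of `E` in the relative canonical divisor
`K_{S̃} - φ^* K_S`. The latter is the divisor of the Jacobian determinant of
`φ^* Ω_S → Ω_{S̃}`; its order along `E` is the length over the discrete valuation ring `V` of the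
cokernel, the module of relative differentials. -/
noncomputable def discrepancy (O V : LocalSubring K) (h : O.toSubring ≤ V.toSubring) : ℕ∞ :=
  letI : Algebra O.toSubring V.toSubring := (Subring.inclusion h).toAlgebra
  Module.length V.toSubring (Ω[V.toSubring⁄O.toSubring])

end SurfaceGerm

/-! Let `f` have order `k` at `x_0`. If `E = E_1`, the discrepancy is at least 1 and the order of
`f` along `E` is at most `k`, so `2n < k`.

Otherwise the centre of `E` on `S_1` is `x_1`. There `f = t^k f'`, where `t` is an equation of `E_1`
and `f'` one of the strict transform, of order `l ≤ k` at `x_1`. Let `a` be the order along `E` of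
the maximal ideal at `x_0`, and `s` the sum of the orders of the maximal ideals at the later
centres. Three estimates suffice: the order of `f` along `E` is at most `k a + l s`
(`DivisorOver.ord_le` applied to `f'`); the discrepancy is at least `a + s`
(`DivisorOver.le_discrepancy`); and `a ≤ s`, since `E_1` is smooth at `x_1`. Thus `n (a + s + 1) < k
a + l s`, while `l ≤ k` and `a ≤ s` give `2 (k a + l s) ≤ (k + l) (a + s)` by Chebyshev's
inequality, so `k + l > 2n` (`two_mul_lt_of_lt`).

The blow-up is computed in charts `R[X]/(tX - y)`, whose reduction modulo `t` is a polynomial ring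
over the residue field. The bound on the discrepancy, a length of differentials, comes from
derivations into `K/V`: this module is divisible, so derivations extend through successive blow-ups,
and it has elements with annihilator exactly `(t)`. -/

namespace SurfaceGerm

/-! ### Parameters in a local ring with two-generated maximal ideal of height at least two -/

section LocalRing

variable {R : Type*} [CommRing R] [IsLocalRing R]

theorem exists_span_pair_of_notMem_sq {t u v : R} (h : maximalIdeal R = Ideal.span {u, v})
    (ht : t ∈ maximalIdeal R) (ht2 : t ∉ maximalIdeal R ^ 2) :
    ∃ y, maximalIdeal R = Ideal.span {t, y} := by
  have hu : u ∈ maximalIdeal R := h ▸ Ideal.subset_span (by simp)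
  have hv : v ∈ maximalIdeal R := h ▸ Ideal.subset_span (by simp)
  obtain ⟨a, b, hab⟩ := Ideal.mem_span_pair.1 (h ▸ ht)
  -- A unit coefficient lets `t` replace the corresponding generator; if neither is a unit, `t` lies
  -- in the square.
  by_cases ha : IsUnit a
  · obtain ⟨a', ha'⟩ := ha.exists_left_inv
    refine ⟨v, le_antisymm ?_ ?_⟩
    · rw [h, Ideal.span_le]
      rintro z (rfl | rfl)
      · exact Ideal.mem_span_pair.2 ⟨a', -a' * b, by linear_combination -a' * hab + z * ha'⟩
      · exact Ideal.subset_span (by simp)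
    · rw [Ideal.span_le]
      rintro z (rfl | rfl) <;> assumption
  by_cases hb : IsUnit b
  · obtain ⟨b', hb'⟩ := hb.exists_left_inv
    refine ⟨u, le_antisymm ?_ ?_⟩
    · rw [h, Ideal.span_le]
      rintro z (rfl | rfl)
      · exact Ideal.subset_span (by simp)
      · exact Ideal.mem_span_pair.2 ⟨b', -b' * a, by linear_combination -b' * hab + z * hb'⟩
    · rw [Ideal.span_le]
      rintro z (rfl | rfl) <;> assumption
  refine absurd ?_ ht2
  rw [← hab, sq]
  exact add_mem (Ideal.mul_mem_mul ha hu) (Ideal.mul_mem_mul hb hv)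

variable [IsNoetherianRing R]

theorem maximalIdeal_ne_span_singleton (hR : 2 ≤ (maximalIdeal R).height) (w : R) :
    maximalIdeal R ≠ Ideal.span {w} := by
  intro h
  have : (maximalIdeal R).height ≤ 1 := by
    refine Ideal.height_le_one_of_isPrincipal_of_mem_minimalPrimes (Ideal.span {w}) _ ?_
    rw [← h, Ideal.minimalPrimes_eq_subsingleton_self]
    rfl
  exact absurd (hR.trans this) (by decide)

/-- Otherwise `𝔪 = (y) + 𝔪²`, so `𝔪 = (y)` by Nakayama, against the height. -/
theorem notMem_sq_of_span_pair {t y : R} (hm : maximalIdeal R = Ideal.span {t, y})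
    (hR : 2 ≤ (maximalIdeal R).height) : t ∉ maximalIdeal R ^ 2 := by
  intro ht
  refine maximalIdeal_ne_span_singleton hR y (le_antisymm ?_ ?_)
  · refine Submodule.le_of_le_smul_of_le_jacobson_bot (I := maximalIdeal R)
      (IsNoetherian.noetherian _) (maximalIdeal_le_jacobson _) ?_
    conv_lhs => rw [hm]
    rw [Ideal.span_le]
    rintro z (rfl | rfl)
    · exact Submodule.mem_sup_right (by rwa [smul_eq_mul, ← sq])
    · exact Submodule.mem_sup_left (Ideal.mem_span_singleton_self _)
  · rw [hm]
    exact Ideal.span_mono (by simp)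

/-- Any prime containing `t` would contain `y`, so `𝔪` would be minimal over `(t)` and of height at
most one by Krull. -/
theorem not_dvd_pow_of_span_pair {t y : R} (hm : maximalIdeal R = Ideal.span {t, y})
    (hR : 2 ≤ (maximalIdeal R).height) (n : ℕ) : ¬ t ∣ y ^ n := by
  intro hy
  have : (maximalIdeal R).height ≤ 1 := by
    refine Ideal.height_le_one_of_isPrincipal_of_mem_minimalPrimes (Ideal.span {t}) _ ⟨⟨inferInstance,
      ?_⟩, ?_⟩
    · rw [hm]
      exact Ideal.span_mono (by simp)
    · rintro q ⟨hq, htq⟩ -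
      rw [hm, Ideal.span_le]
      have ht : t ∈ q := htq (Ideal.mem_span_singleton_self t)
      rintro z (rfl | rfl)
      · exact ht
      · exact hq.mem_of_pow_mem n (Ideal.mem_of_dvd _ hy ht)
  exact absurd (hR.trans this) (by decide)

/-- Modulo `t` the maximal ideal is generated by `y`, and the ring is `𝔪`-adically separated, so
every nonzero element is a unit times a power of `y`. This replaces the theorem that regular local
rings are domains in the proof that `t` is prime. -/
theorem exists_eq_mul_add_pow_mul {t y : R} (hm : maximalIdeal R = Ideal.span {t, y})
    {a : R} (ha : ¬ t ∣ a) : ∃ (n : ℕ) (u b : R), IsUnit u ∧ a = t * b + y ^ n * u := by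
  have hex : ∃ n, ∀ u b, a ≠ t * b + y ^ (n + 1) * u := by
    by_contra! h
    refine ha ?_
    rw [← Ideal.mem_span_singleton]
    have hcl := IsHausdorff.of_le_jacobson (maximalIdeal R) (R ⧸ Ideal.span {t})
      (maximalIdeal_le_jacobson _)
    rw [← Ideal.Quotient.eq_zero_iff_mem]
    refine hcl.haus' _ fun n => ?_
    rw [SModEq.zero]
    obtain ⟨u, b, hub⟩ := h n
    have : (Ideal.Quotient.mk (Ideal.span {t}) a) =
        (y ^ n) • Ideal.Quotient.mk (Ideal.span {t}) (y * u) := by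
      rw [Algebra.smul_def, Ideal.Quotient.algebraMap_eq, ← map_mul,
        Ideal.Quotient.mk_eq_mk_iff_sub_mem, Ideal.mem_span_singleton]
      exact ⟨b, by rw [hub]; ring⟩
    rw [this]
    refine Submodule.smul_mem_smul (Ideal.pow_mem_pow ?_ n) trivial
    rw [hm]
    exact Ideal.subset_span (by simp)
  classical
  obtain hn := Nat.find_spec hex
  have key : ∃ u b, a = t * b + y ^ (Nat.find hex) * u := by
    rcases h : Nat.find hex with _ | n
    · exact ⟨a, 0, by simp⟩
    · have := Nat.find_min hex (m := n) (by omega)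
      push Not at this
      exact this
  obtain ⟨u, b, hub⟩ := key
  refine ⟨_, u, b, ?_, hub⟩
  -- A non-unit `u = p t + q y` would allow one more factor `y`, against the choice of the exponent.
  by_contra hu
  obtain ⟨p, q, hpq⟩ := Ideal.mem_span_pair.1 (hm ▸ (mem_maximalIdeal u).2 hu)
  refine hn q (b + y ^ (Nat.find hex) * p) (hub.trans ?_)
  rw [← hpq]
  ring

theorem prime_of_span_pair {t y : R} (hm : maximalIdeal R = Ideal.span {t, y})
    (hR : 2 ≤ (maximalIdeal R).height) : Prime t := by
  have ht : t ∈ maximalIdeal R := hm ▸ Ideal.subset_span (by simp)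
  refine ⟨?_, (mem_maximalIdeal t).1 ht, ?_⟩
  · rintro rfl
    exact notMem_sq_of_span_pair hm hR (zero_mem _)
  · intro a b hab
    by_contra! h
    obtain ⟨n, u, a', hu, rfl⟩ := exists_eq_mul_add_pow_mul hm h.1
    obtain ⟨k, v, b', hv, rfl⟩ := exists_eq_mul_add_pow_mul hm h.2
    refine not_dvd_pow_of_span_pair hm hR (n + k) ?_
    rw [← (hu.mul hv).dvd_mul_right]
    obtain ⟨c, hc⟩ := hab
    exact ⟨c - a' * (t * b' + y ^ k * v) - b' * y ^ n * u, by linear_combination hc⟩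

end LocalRing

/-! ### Charts of the blow-up as quotients `R[X]/(tX - y)` -/

section Chart

open Polynomial

/-- `e` presents `C` as the chart `R[y / t] = R[X] / (t X - y)` of a blow-up. -/
structure IsChart {R C : Type*} [CommRing R] [CommRing C] (t y : R) (e : R[X] →+* C) : Prop where
  surjective : Function.Surjective e
  ker : RingHom.ker e = Ideal.span {Polynomial.C t * X - Polynomial.C y}

/-- Division by `tX - y`, although `t` is not a unit: clearing denominators in `g(y/t) = 0` shows
that the prime `t` divides the leading coefficient times a power of `y`, hence the leading
coefficient, so the degree can be lowered. -/
theorem C_mul_X_sub_C_dvd_of_eval₂_eq_zero {R K : Type*} [CommRing R] [IsDomain R] [Field K]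
    (i : R →+* K) (hi : Function.Injective i) {t y : R} (ht : Prime t) (hy : ¬ t ∣ y) (g : R[X])
    (hg : g.eval₂ i (i y / i t) = 0) : C t * X - C y ∣ g := by
  have hit : i t ≠ 0 := by simpa using (map_ne_zero_iff i hi).2 ht.ne_zero
  induction h : g.natDegree using Nat.strong_induction_on generalizing g with
  | _ n ih =>
    subst h
    rcases Nat.eq_zero_or_pos g.natDegree with h0 | h0
    · rw [eq_C_of_natDegree_eq_zero h0, eval₂_C, map_eq_zero_iff i hi] at hg
      rw [eq_C_of_natDegree_eq_zero h0, hg, C_0]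
      exact dvd_zero _
    obtain ⟨d, hd⟩ : ∃ d, g.natDegree = d + 1 := ⟨g.natDegree - 1, by omega⟩
    have hlead : t ∣ g.leadingCoeff := by
      have hsum : ∑ j ∈ Finset.range (d + 1), g.coeff j * y ^ j * t ^ (d + 1 - j) +
          g.leadingCoeff * y ^ (d + 1) = 0 := by
        apply hi
        rw [eval₂_eq_sum_range, hd, Finset.sum_range_succ] at hg
        have := congrArg (· * i t ^ (d + 1)) hg
        simp only [add_mul, zero_mul, Finset.sum_mul] at this
        rw [map_zero, ← this, map_add, map_sum]
        congr 1
        · refine Finset.sum_congr rfl fun j hj => ?_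
          have : d + 1 = j + (d + 1 - j) := by have := Finset.mem_range.1 hj; omega
          rw [map_mul, map_mul, map_pow, map_pow, div_pow]
          conv_rhs => rw [this, pow_add]
          field_simp
        · rw [map_mul, map_pow, div_pow, leadingCoeff, hd]
          field_simp
      have h1 : t ∣ g.leadingCoeff * y ^ (d + 1) := by
        rw [← dvd_add_right (a := t) (b := _) (Finset.dvd_sum fun j hj => ?_), hsum]
        · exact dvd_zero _
        · exact Dvd.dvd.mul_left (dvd_pow_self _ (by have := Finset.mem_range.1 hj; omega)) _
      exact (ht.dvd_or_dvd h1).resolve_right fun h => hy (ht.dvd_of_dvd_pow h)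
    obtain ⟨b, hb⟩ := hlead
    set q : R[X] := C t * X - C y with hq
    have hqe : q.eval₂ i (i y / i t) = 0 := by
      simp [hq, mul_div_cancel₀ _ hit]
    have hqd : q.natDegree ≤ 1 := by rw [hq]; compute_degree
    set g' := g - C b * X ^ d * q with hg'
    have hg'e : g'.eval₂ i (i y / i t) = 0 := by
      rw [hg', eval₂_sub, eval₂_mul, hqe, hg, mul_zero, sub_zero]
    have hdvd : q ∣ g' := by
      refine ih _ ?_ g' hg'e rfl
      have hle : g'.natDegree ≤ d := by
        rw [natDegree_le_iff_coeff_eq_zero]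
        intro N hN
        rcases (show d + 1 ≤ N from hN).eq_or_lt with rfl | hN'
        · rw [hg', coeff_sub, mul_assoc, coeff_C_mul, add_comm d 1, coeff_X_pow_mul, hq]
          have : g.coeff (1 + d) = t * b := by rw [← hb, leadingCoeff, hd, add_comm]
          simp [this, coeff_C]
          ring
        · rw [hg', coeff_sub, coeff_eq_zero_of_natDegree_lt (by omega), zero_sub, neg_eq_zero]
          refine coeff_eq_zero_of_natDegree_lt (lt_of_le_of_lt ?_ hN')
          refine natDegree_mul_le.trans (Nat.add_le_add ?_ hqd)
          exact natDegree_C_mul_X_pow_le _ _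
      omega
    have : g = g' + C b * X ^ d * q := by rw [hg']; ring
    rw [this]
    exact dvd_add hdvd (dvd_mul_left _ _)

theorem IsChart.map_C_y {R C : Type*} [CommRing R] [CommRing C] {t y : R} {e : R[X] →+* C}
    (he : IsChart t y e) :
    e (Polynomial.C y) = e (Polynomial.C t) * e X := by
  have : Polynomial.C t * X - Polynomial.C y ∈ RingHom.ker e :=
    he.ker ▸ Ideal.mem_span_singleton_self _
  rw [RingHom.mem_ker, map_sub, map_mul, sub_eq_zero] at this
  exact this.symm

variable {R : Type*} [CommRing R] [IsLocalRing R]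

theorem exists_coeff_of_mem_pow {t y : R} (hm : maximalIdeal R = Ideal.span {t, y}) (k : ℕ) :
    ∀ f ∈ maximalIdeal R ^ k, ∃ g : R[X], g.natDegree ≤ k ∧
      f = ∑ j ∈ Finset.range (k + 1), g.coeff j * t ^ (k - j) * y ^ j := by
  induction k with
  | zero => exact fun f _ => ⟨C f, by simp⟩
  | succ k ih =>
    intro f hf
    rw [pow_succ] at hf
    refine Submodule.mul_induction_on hf ?_ ?_
    · intro a ha b hb
      obtain ⟨g, hg, rfl⟩ := ih a ha
      obtain ⟨p, q, rfl⟩ := Ideal.mem_span_pair.1 (hm ▸ hb)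
      -- The coefficients of `g` encode a form of degree `k` in `t, y`. The factor `t` keeps the
      -- index of a coefficient, the factor `y` shifts it by one.
      refine ⟨C p * g + C q * (g * X), ?_, ?_⟩
      · refine natDegree_add_le_of_degree_le ?_ ?_
        · exact (natDegree_C_mul_le _ _).trans (hg.trans k.le_succ)
        · exact (natDegree_C_mul_le _ _).trans
            (natDegree_mul_le.trans (Nat.add_le_add hg natDegree_X_le))
      · simp only [coeff_add, coeff_C_mul, add_mul, Finset.sum_add_distrib, mul_add]
        congr 1
        · rw [Finset.sum_range_succ _ (k + 1), coeff_eq_zero_of_natDegree_lt (Nat.lt_succ_of_le hg),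
            Finset.sum_mul]
          simp only [mul_zero, zero_mul, add_zero]
          refine Finset.sum_congr rfl fun j hj => ?_
          rw [Nat.succ_sub (Nat.lt_succ_iff.1 (Finset.mem_range.1 hj)), pow_succ]
          ring
        · rw [Finset.sum_range_succ' _ (k + 1), Finset.sum_mul]
          simp only [coeff_mul_X, mul_coeff_zero, coeff_X_zero, mul_zero, zero_mul, add_zero]
          refine Finset.sum_congr rfl fun j hj => ?_
          rw [Nat.add_sub_add_right, pow_succ]
          ring
    · rintro a b ⟨g, hg, rfl⟩ ⟨h, hh, rfl⟩
      exact ⟨g + h, natDegree_add_le_of_degree_le hg hh, by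
        simp only [coeff_add, add_mul, Finset.sum_add_distrib]⟩

namespace IsChart

variable {C : Type*} [CommRing C] {t y : R} {e : R[X] →+* C}

theorem map_C_mem (he : IsChart t y e) (hm : maximalIdeal R = Ideal.span {t, y}) {a : R}
    (ha : a ∈ maximalIdeal R) : e (Polynomial.C t) ∣ e (Polynomial.C a) := by
  obtain ⟨p, q, rfl⟩ := Ideal.mem_span_pair.1 (hm ▸ ha)
  refine ⟨e (Polynomial.C p) + e (Polynomial.C q) * e X, ?_⟩
  rw [Polynomial.C_add, Polynomial.C_mul, Polynomial.C_mul, map_add, map_mul, map_mul, he.map_C_y]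
  ring

/-- The reduction of a chart modulo the equation of the exceptional divisor. -/
theorem exists_reduction (he : IsChart t y e) (hm : maximalIdeal R = Ideal.span {t, y}) :
    ∃ π : C →+* (ResidueField R)[X], Function.Surjective π ∧
      (∀ g, π (e g) = g.map (residue R)) ∧ ∀ x, π x = 0 ↔ e (Polynomial.C t) ∣ x := by
  have ht : t ∈ maximalIdeal R := hm ▸ Ideal.subset_span (by simp)
  have hy : y ∈ maximalIdeal R := hm ▸ Ideal.subset_span (by simp)
  have hker : RingHom.ker e ≤ RingHom.ker (mapRingHom (residue R)) := by
    rw [he.ker, Ideal.span_le, Set.singleton_subset_iff]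
    rw [← residue_eq_zero_iff] at ht hy
    simp [RingHom.mem_ker, ht, hy]
  set π := RingHom.liftOfSurjective e he.surjective ⟨mapRingHom (residue R), hker⟩ with hπ
  have hπe : ∀ g, π (e g) = g.map (residue R) := fun g => by
    have := RingHom.liftOfSurjective_comp e he.surjective ⟨mapRingHom (residue R), hker⟩
    exact congrArg (· g) (congrArg DFunLike.coe this)
  refine ⟨π, ?_, hπe, fun x => ⟨fun hx => ?_, ?_⟩⟩
  · intro g
    obtain ⟨g, rfl⟩ := Polynomial.map_surjective _ residue_surjective g
    exact ⟨e g, hπe g⟩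
  · obtain ⟨g, rfl⟩ := he.surjective x
    rw [hπe] at hx
    have hg : g ∈ Ideal.map Polynomial.C (maximalIdeal R) := by
      rw [Ideal.mem_map_C_iff]
      intro n
      rw [← residue_eq_zero_iff, ← coeff_map, hx, coeff_zero]
    have := Ideal.mem_map_of_mem e hg
    rw [Ideal.map_map] at this
    rw [← Ideal.mem_span_singleton]
    refine Ideal.map_le_iff_le_comap.2 (fun a ha => ?_) this
    exact Ideal.mem_span_singleton.2 (he.map_C_mem hm ha)
  · rintro ⟨c, rfl⟩
    rw [map_mul, hπe, map_C, (residue_eq_zero_iff _).2 ht, C_0, zero_mul]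

/-- An element of order exactly `k` of the regular local ring is, in a chart of the blow-up, the
`k`-th power of the equation of the exceptional divisor times an element whose restriction to the
exceptional divisor is a nonzero polynomial of degree at most `k`. -/
theorem exists_strict (he : IsChart t y e) (hm : maximalIdeal R = Ideal.span {t, y})
    {π : C →+* (ResidueField R)[X]} (hπ : ∀ g, π (e g) = g.map (residue R)) {k : ℕ} {f : R}
    (hf : f ∈ maximalIdeal R ^ k) (hf' : f ∉ maximalIdeal R ^ (k + 1)) :
    ∃ f' : C, e (Polynomial.C f) = e (Polynomial.C t) ^ k * f' ∧ π f' ≠ 0 ∧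
      (π f').natDegree ≤ k := by
  have ht : t ∈ maximalIdeal R := hm ▸ Ideal.subset_span (by simp)
  have hy : y ∈ maximalIdeal R := hm ▸ Ideal.subset_span (by simp)
  obtain ⟨g, hg, rfl⟩ := exists_coeff_of_mem_pow hm k f hf
  refine ⟨e g, ?_, fun h => hf' ?_, ?_⟩
  · conv_rhs => rw [g.as_sum_range' (k + 1) (Nat.lt_succ_of_le hg)]
    simp only [map_sum, Finset.mul_sum]
    refine Finset.sum_congr rfl fun j hj => ?_
    have hj' : k = (k - j) + j := by have := Finset.mem_range.1 hj; omega
    rw [← Polynomial.C_mul_X_pow_eq_monomial]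
    simp only [map_mul, map_pow, he.map_C_y]
    conv_rhs => rw [hj', pow_add]
    ring
  -- If the reduction vanishes, every coefficient lies in `𝔪`, and the form of degree `k` then lies
  -- in `𝔪 ^ (k + 1)`.
  · refine sum_mem fun j hj => ?_
    have hj' : k + 1 = 1 + (k - j) + j := by have := Finset.mem_range.1 hj; omega
    rw [hj', pow_add, pow_add, pow_one]
    refine Ideal.mul_mem_mul (Ideal.mul_mem_mul ?_ (Ideal.pow_mem_pow ht _)) (Ideal.pow_mem_pow hy _)
    rw [hπ] at h
    rw [← residue_eq_zero_iff, ← coeff_map, h, coeff_zero]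
  · rw [hπ]
    exact natDegree_map_le.trans hg

end IsChart

end Chart

/-! ### Closed points of the exceptional line and their local rings -/

namespace IsChart

open Polynomial

variable {R : Type*} [CommRing R] [IsLocalRing R] {C : Type*} [CommRing C]
  {t y : R} {e : R[X] →+* C}

/-- A closed point of the exceptional divisor is the zero of a coordinate on that line. -/
theorem exists_center [IsAlgClosed (ResidueField R)] {π : C →+* (ResidueField R)[X]}
    (hsurj : Function.Surjective π) (hker : ∀ x, π x = 0 ↔ e (Polynomial.C t) ∣ x)
    {P : Ideal C} [hP : P.IsMaximal] (htP : e (Polynomial.C t) ∈ P) :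
    ∃ c : R, ∀ x, x ∈ P ↔ (π x).IsRoot (residue R c) := by
  have hkerP : RingHom.ker π ≤ P := by
    intro x hx
    exact Ideal.mem_of_dvd _ ((hker x).1 hx) htP
  have hcomap : (P.map π).comap π = P := by
    rw [Ideal.comap_map_of_surjective π hsurj, ← RingHom.ker_eq_comap_bot, sup_eq_left.2 hkerP]
  have hmax : (P.map π).IsMaximal := by
    refine (Ideal.map_eq_top_or_isMaximal_of_surjective π hsurj hP).resolve_left fun h => ?_
    rw [h, Ideal.comap_top] at hcomap
    exact hP.ne_top hcomap.symm
  have hbot : P.map π ≠ ⊥ :=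
    Ring.ne_bot_of_isMaximal_of_not_isField hmax (Polynomial.not_isField _)
  obtain ⟨p, hp, hp0⟩ := Submodule.exists_mem_ne_zero_of_ne_bot hbot
  have hroot : ∃ a : ResidueField R, X - Polynomial.C a ∈ P.map π := by
    have hs := IsAlgClosed.splits p
    rw [hs.eq_prod_roots] at hp
    rcases hmax.isPrime.mem_or_mem hp with h | h
    · refine absurd ((P.map π).eq_top_of_isUnit_mem h ?_) hmax.ne_top
      exact isUnit_C.2 (isUnit_iff_ne_zero.2 (leadingCoeff_ne_zero.2 hp0))
    · obtain ⟨q, hq, hqP⟩ := (hmax.isPrime.multiset_prod_mem_iff_exists_mem _).1 h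
      obtain ⟨a, -, rfl⟩ := Multiset.mem_map.1 hq
      exact ⟨a, hqP⟩
  obtain ⟨a, ha⟩ := hroot
  obtain ⟨c, rfl⟩ := residue_surjective a
  have hspan : P.map π = Ideal.span {X - Polynomial.C (residue R c)} := by
    symm
    refine (PrincipalIdealRing.isMaximal_of_irreducible (irreducible_X_sub_C _)).eq_of_le
      hmax.ne_top ?_
    rwa [Ideal.span_le, Set.singleton_subset_iff]
  refine ⟨c, fun x => ?_⟩
  rw [← hcomap, Ideal.mem_comap, hspan, Ideal.mem_span_singleton, dvd_iff_isRoot]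

variable {P : Ideal C} {π : C →+* (ResidueField R)[X]} {c : R}

theorem eq_span_of_center (hsurj : Function.Surjective π)
    (hπ : ∀ g, π (e g) = g.map (residue R)) (hker : ∀ x, π x = 0 ↔ e (Polynomial.C t) ∣ x)
    (htP : e (Polynomial.C t) ∈ P) (hc : ∀ x, x ∈ P ↔ (π x).IsRoot (residue R c)) :
    P = Ideal.span {e (Polynomial.C t), e (X - Polynomial.C c)} := by
  refine le_antisymm (fun x hx => ?_) ?_
  · obtain ⟨q, hq⟩ := dvd_iff_isRoot.2 ((hc x).1 hx)
    obtain ⟨z, rfl⟩ := hsurj q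
    have : π (x - e (X - Polynomial.C c) * z) = 0 := by
      rw [map_sub, map_mul, hπ, hq]
      simp
    obtain ⟨d, hd⟩ := (hker _).1 this
    exact Ideal.mem_span_pair.2 ⟨d, z, by linear_combination -hd⟩
  · rw [Ideal.span_le]
    rintro x (rfl | rfl)
    · exact htP
    · refine (hc _).2 ?_
      rw [hπ]
      simp

section Localization

variable [P.IsPrime] {B : Type*} [CommRing B] [IsLocalRing B] [Algebra C B]
  [IsLocalization.AtPrime B P]

theorem maximalIdeal_eq_span_of_center (hsurj : Function.Surjective π)
    (hπ : ∀ g, π (e g) = g.map (residue R)) (hker : ∀ x, π x = 0 ↔ e (Polynomial.C t) ∣ x)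
    (htP : e (Polynomial.C t) ∈ P) (hc : ∀ x, x ∈ P ↔ (π x).IsRoot (residue R c)) :
    maximalIdeal B = Ideal.span {algebraMap C B (e (Polynomial.C t)),
      algebraMap C B (e (X - Polynomial.C c))} := by
  rw [← IsLocalization.AtPrime.map_eq_maximalIdeal P B,
    eq_span_of_center hsurj hπ hker htP hc, Ideal.map_span, Set.image_pair]

theorem exists_sub_map_C_mem_maximalIdeal (hπ : ∀ g, π (e g) = g.map (residue R))
    (hc : ∀ x, x ∈ P ↔ (π x).IsRoot (residue R c)) (b : B) :
    ∃ a : R, b - algebraMap C B (e (Polynomial.C a)) ∈ maximalIdeal B := by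
  obtain ⟨p, s, rfl⟩ := IsLocalization.exists_mk'_eq P.primeCompl b
  have hs : (π s).eval (residue R c) ≠ 0 := fun h => s.2 ((hc _).2 h)
  -- The value of the fraction `p / s` at the centre, lifted to `R`.
  obtain ⟨a, ha⟩ := residue_surjective ((π p).eval (residue R c) / (π s).eval (residue R c))
  refine ⟨a, ?_⟩
  have hmem : p - e (Polynomial.C a) * s ∈ P := by
    rw [hc, map_sub, map_mul, hπ, IsRoot.def, eval_sub, eval_mul, Polynomial.map_C, eval_C, ha,
      div_mul_cancel₀ _ hs, sub_self]
  have hu : IsUnit (algebraMap C B s) := IsLocalization.map_units B s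
  rw [← Ideal.mul_unit_mem_iff_mem _ hu, sub_mul, IsLocalization.mk'_spec, ← map_mul, ← map_sub,
    ← IsLocalization.AtPrime.map_eq_maximalIdeal P B]
  exact Ideal.mem_map_of_mem _ hmem

variable [IsDomain C]

omit [IsLocalRing B] in
theorem not_dvd_algebraMap (hker : ∀ x, π x = 0 ↔ e (Polynomial.C t) ∣ x)
    (htP : e (Polynomial.C t) ∈ P) {x : C} (hx : π x ≠ 0) :
    ¬ algebraMap C B (e (Polynomial.C t)) ∣ algebraMap C B x := by
  rintro ⟨b, hb⟩
  obtain ⟨p, s, rfl⟩ := IsLocalization.exists_mk'_eq P.primeCompl b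
  have hinj := IsLocalization.injective B P.primeCompl_le_nonZeroDivisors
  have : x * s = e (Polynomial.C t) * p := by
    apply hinj
    rw [map_mul, hb, mul_assoc, IsLocalization.mk'_spec, map_mul]
  have h0 : π (x * s) = 0 := (hker _).2 ⟨p, this⟩
  rw [map_mul] at h0
  rcases mul_eq_zero.1 h0 with h | h
  · exact hx h
  · exact s.2 (Ideal.mem_of_dvd _ ((hker _).1 h) htP)

/-- A nonzero polynomial of degree at most `k` on the exceptional line cannot vanish to order `k +
1` at a point. This is why multiplicity does not increase under strict transform. -/
theorem algebraMap_notMem_pow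
    (hc : ∀ x, x ∈ P ↔ (π x).IsRoot (residue R c)) {x : C} (hx : π x ≠ 0) {k : ℕ}
    (hk : (π x).natDegree ≤ k) : algebraMap C B x ∉ maximalIdeal B ^ (k + 1) := by
  rw [← IsLocalization.AtPrime.map_eq_maximalIdeal P B, ← Ideal.map_pow,
    IsLocalization.mem_map_algebraMap_iff P.primeCompl]
  rintro ⟨⟨⟨a, ha⟩, s⟩, h⟩
  have hinj := IsLocalization.injective B P.primeCompl_le_nonZeroDivisors
  rw [← map_mul] at h
  have h := hinj h
  have hle : P.map π ≤ Ideal.span {X - Polynomial.C (residue R c)} := by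
    rw [Ideal.map_le_iff_le_comap]
    intro z hz
    exact Ideal.mem_span_singleton.2 (dvd_iff_isRoot.2 ((hc z).1 hz))
  have hdvd : (X - Polynomial.C (residue R c)) ^ (k + 1) ∣ π x * π s := by
    rw [← map_mul, h, ← Ideal.mem_span_singleton, ← Ideal.span_singleton_pow]
    refine Ideal.pow_right_mono hle _ ?_
    rw [← Ideal.map_pow]
    exact Ideal.mem_map_of_mem _ ha
  have hdvd := (prime_X_sub_C _).pow_dvd_of_dvd_mul_right _
    (fun h => s.2 ((hc _).2 (dvd_iff_isRoot.1 h))) hdvd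
  have := natDegree_le_of_dvd hdvd hx
  rw [natDegree_pow, natDegree_X_sub_C] at this
  omega

/-- The chain `0 ⊂ (t) ⊂ 𝔪` is strict: `(t)` is prime because the reduction is a domain, and the
coordinate at the centre is not divisible by `t`. -/
theorem two_le_height [IsNoetherianRing B]
    (hπ : ∀ g, π (e g) = g.map (residue R)) (hker : ∀ x, π x = 0 ↔ e (Polynomial.C t) ∣ x)
    (ht0 : e (Polynomial.C t) ≠ 0)
    (htP : e (Polynomial.C t) ∈ P) (hc : ∀ x, x ∈ P ↔ (π x).IsRoot (residue R c)) :
    2 ≤ (maximalIdeal B).height := by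
  have hinj := IsLocalization.injective B P.primeCompl_le_nonZeroDivisors
  have : IsDomain B := IsLocalization.isDomain_of_le_nonZeroDivisors B P.primeCompl_le_nonZeroDivisors
  have hspan : RingHom.ker π = Ideal.span {e (Polynomial.C t)} := by
    ext x
    rw [RingHom.mem_ker, hker, Ideal.mem_span_singleton]
  have hprime : (Ideal.span {algebraMap C B (e (Polynomial.C t))}).IsPrime := by
    have h := IsLocalization.isPrime_of_isPrime_disjoint P.primeCompl B (RingHom.ker π)
      (RingHom.ker_isPrime π) ?_
    · rwa [hspan, Ideal.map_span, Set.image_singleton] at h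
    · rw [Set.disjoint_left]
      intro x hx hx'
      exact hx (Ideal.mem_of_dvd _ ((hker x).1 hx') htP)
  set w := e (X - Polynomial.C c)
  have hw : w ∈ P := (hc _).2 (by rw [hπ]; simp)
  have hw0 : π w ≠ 0 := by
    rw [hπ]
    simpa using X_sub_C_ne_zero (residue R c)
  have h1 : (⊥ : Ideal B) < Ideal.span {algebraMap C B (e (Polynomial.C t))} := by
    rw [bot_lt_iff_ne_bot, Ne, Ideal.span_singleton_eq_bot, map_eq_zero_iff _ hinj]
    exact ht0
  have h2 : Ideal.span {algebraMap C B (e (Polynomial.C t))} < maximalIdeal B := by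
    rw [← IsLocalization.AtPrime.map_eq_maximalIdeal P B]
    refine lt_of_le_of_ne ?_ fun h => ?_
    · rw [Ideal.span_le, Set.singleton_subset_iff]
      exact Ideal.mem_map_of_mem _ htP
    · have := Ideal.mem_map_of_mem (algebraMap C B) hw
      rw [← h, Ideal.mem_span_singleton] at this
      exact not_dvd_algebraMap hker htP hw0 this
  have h1 := Ideal.height_strict_mono_of_isPrime_of_isPrime h1
  have h2 := Ideal.height_strict_mono_of_isPrime_of_isPrime h2
  exact (Order.add_one_le_of_lt (lt_of_le_of_lt (Order.one_le_iff_pos.2 (pos_of_gt h1)) h2) :)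

end Localization

end IsChart

/-! ### Differentials and extension of derivations -/

section Differentials

open Polynomial

/-- A derivation over `A` that does not kill `z ∈ B` bounds from below the part of `Ω[V⁄A]` coming
from `B`. -/
theorem length_quotient_add_length_kaehlerDifferential_le {A B V T : Type*} [CommRing A]
    [CommRing B] [CommRing V] [Algebra A B] [Algebra B V] [Algebra A V] [IsScalarTower A B V]
    [AddCommGroup T] [Module V T] [Module A T] [IsScalarTower A V T] (D : Derivation A V T) (z : B)
    (t : V) (hz : ∀ r : V, r • D (algebraMap B V z) = 0 → t ∣ r) :
    Module.length V (V ⧸ Ideal.span {t}) + Module.length V Ω[V⁄B] ≤ Module.length V Ω[V⁄A] := by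
  set g : Ω[V⁄A] →ₗ[V] Ω[V⁄B] := KaehlerDifferential.map A B V V
  have hg : g (KaehlerDifferential.D A V (algebraMap B V z)) = 0 := by
    rw [KaehlerDifferential.map_D, Algebra.algebraMap_self, RingHom.id_apply,
      Derivation.map_algebraMap]
  rw [Module.length_eq_add_of_exact (LinearMap.ker g).subtype g (Submodule.subtype_injective _)
    (KaehlerDifferential.map_surjective A B V) (LinearMap.exact_subtype_ker_map g)]
  gcongr
  set h : V →ₗ[V] LinearMap.ker g :=
    LinearMap.toSpanSingleton V _ ⟨KaehlerDifferential.D A V (algebraMap B V z), hg⟩ with hh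
  -- A relation `r dz = 0` is carried by `D` to `r D z = 0`, so `V/(t)` is a quotient of the
  -- submodule generated by `dz`.
  have hle : LinearMap.ker h ≤ Ideal.span {t} := by
    intro r hr
    rw [Ideal.mem_span_singleton]
    refine hz r ?_
    have := congrArg Subtype.val (LinearMap.mem_ker.1 hr)
    have := congrArg D.liftKaehlerDifferential this
    simpa [hh] using this
  refine (Module.length_le_of_surjective (Submodule.factor hle)
    (Submodule.factor_surjective hle)).trans ?_
  exact Module.length_le_of_injective ((LinearMap.ker h).liftQ h le_rfl)
    (LinearMap.ker_eq_bot.1 (Submodule.ker_liftQ_eq_bot' _ _ rfl))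

variable {V T : Type*} [CommRing V] [AddCommGroup T] [Module V T] [Module Vᵐᵒᵖ T]
  [IsCentralScalar V T]

/-- A ring map to `V ⊕ T` over `j` is a derivation into `T`. The hypothesis on `τ`, the prescribed
derivative of `X`, is the relation `tX = y` differentiated. -/
theorem IsChart.exists_lift_trivSqZeroExt {R C : Type*} [CommRing R] [CommRing C] {t y : R}
    {e : R[X] →+* C} (he : IsChart t y e) (j : C →+* V) (φ : R →+* TrivSqZeroExt V T)
    (hφ : ∀ r, (φ r).fst = j (e (Polynomial.C r))) (τ : T)
    (hτ : j (e (Polynomial.C t)) • τ + j (e X) • (φ t).snd = (φ y).snd) :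
    ∃ φ' : C →+* TrivSqZeroExt V T, (∀ r, φ' (e (Polynomial.C r)) = φ r) ∧
      (∀ c, (φ' c).fst = j c) ∧ (φ' (e X)).snd = τ := by
  set ψ : R[X] →+* TrivSqZeroExt V T :=
    eval₂RingHom φ (TrivSqZeroExt.inl (j (e X)) + TrivSqZeroExt.inr τ) with hψ
  have hker : RingHom.ker e ≤ RingHom.ker ψ := by
    rw [he.ker, Ideal.span_le, Set.singleton_subset_iff, SetLike.mem_coe, RingHom.mem_ker, map_sub,
      map_mul, sub_eq_zero]
    simp only [hψ, coe_eval₂RingHom, eval₂_C, eval₂_X]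
    ext
    · simp [hφ, he.map_C_y]
    · simp [hφ, hτ]
  set φ' := RingHom.liftOfSurjective e he.surjective ⟨ψ, hker⟩
  have hφ' : ∀ g, φ' (e g) = ψ g := fun g =>
    congrArg (· g) (congrArg DFunLike.coe
      (RingHom.liftOfSurjective_comp e he.surjective ⟨ψ, hker⟩))
  refine ⟨φ', fun r => by rw [hφ', hψ, coe_eval₂RingHom, eval₂_C], fun c => ?_, ?_⟩
  · obtain ⟨g, rfl⟩ := he.surjective c
    rw [hφ']
    have : ((TrivSqZeroExt.fstHom V V T : _ →+* V).comp ψ) = j.comp e := by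
      refine Polynomial.ringHom_ext (fun r => ?_) ?_
      · simp [hψ, hφ]
      · simp [hψ]
    exact congrArg (· g) (congrArg DFunLike.coe this)
  · rw [hφ']
    simp [hψ]

/-- An element of a square-zero extension is a unit as soon as its first component is, so the
section extends to fractions. -/
theorem exists_lift_trivSqZeroExt_of_isLocalization {C B : Type*} [CommRing C] [CommRing B]
    [Algebra C B] (M : Submonoid C) [IsLocalization M B] (j : B →+* V)
    (φ : C →+* TrivSqZeroExt V T) (hφ : ∀ c, (φ c).fst = j (algebraMap C B c)) :
    ∃ φ' : B →+* TrivSqZeroExt V T, (∀ c, φ' (algebraMap C B c) = φ c) ∧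
      ∀ b, (φ' b).fst = j b := by
  have hu : ∀ s : M, IsUnit (φ s) := fun s => by
    rw [TrivSqZeroExt.isUnit_iff_isUnit_fst, hφ]
    exact (IsLocalization.map_units B s).map j
  refine ⟨IsLocalization.lift hu, fun c => IsLocalization.lift_eq hu c, fun b => ?_⟩
  have : ((TrivSqZeroExt.fstHom V V T : _ →+* V).comp (IsLocalization.lift hu)) = j := by
    refine IsLocalization.ringHom_ext M (RingHom.ext fun c => ?_)
    simp [hφ]
  exact congrArg (· b) (congrArg DFunLike.coe this)

/-- The derivation given by the second component of a section of `V ⊕ T → V`. -/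
noncomputable def derivationOfTrivSqZeroExt {A : Type*} [CommRing A] [Algebra A V] [Module A T]
    [IsScalarTower A V T] (φ : V →+* TrivSqZeroExt V T) (hφ : ∀ v, (φ v).fst = v)
    (hA : ∀ a : A, (φ (algebraMap A V a)).snd = 0) : Derivation A V T :=
  Derivation.mk'
    { toFun := fun v => (φ v).snd
      map_add' := fun a b => by simp
      map_smul' := fun a b => by
        rw [Algebra.smul_def, map_mul, TrivSqZeroExt.snd_mul, hA, hφ]
        simp }
    (fun a b => by simp [hφ])

end Differentials

universe u

variable {K : Type u} [Field K]

/-! ### The chart `A[𝔪/t]` inside the function field -/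

section Chart

open Polynomial

variable {A : LocalSubring K}

theorem div_mem_chart {t b : A.toSubring} (hb : b ∈ maximalIdeal A.toSubring) :
    (b : K) / t ∈ chart A t :=
  Subring.subset_closure (Or.inr ⟨b, hb, rfl⟩)

/-- The presentation of the chart `A[𝔪/t] = A[y/t]` as a quotient of a polynomial ring, where
`t, y` generate `𝔪`. -/
noncomputable def chartHom (A : LocalSubring K) (t y : A.toSubring)
    (hy : y ∈ maximalIdeal A.toSubring) : A.toSubring[X] →+* chart A (t : K) :=
  eval₂RingHom (Subring.inclusion (le_chart A t)) ⟨(y : K) / t, div_mem_chart hy⟩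

theorem chartHom_C (t y : A.toSubring) (hy : y ∈ maximalIdeal A.toSubring) (a : A.toSubring) :
    chartHom A t y hy (Polynomial.C a) = Subring.inclusion (le_chart A t) a := by
  simp [chartHom]

theorem coe_chartHom_X (t y : A.toSubring) (hy : y ∈ maximalIdeal A.toSubring) :
    (chartHom A t y hy X : K) = (y : K) / t := by
  simp [chartHom]

theorem isChart_chartHom {t y : A.toSubring} (hm : maximalIdeal A.toSubring = Ideal.span {t, y})
    (ht : Prime t) (hty : ¬ t ∣ y) (hy : y ∈ maximalIdeal A.toSubring) :
    IsChart t y (chartHom A t y hy) := by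
  have ht0 : (t : K) ≠ 0 := fun h => ht.ne_zero (Subtype.ext h)
  have hcoe : (chart A (t : K)).subtype.comp (chartHom A t y hy) =
      eval₂RingHom A.toSubring.subtype ((y : K) / t) := by
    refine Polynomial.ringHom_ext (fun r => ?_) ?_
    · simp [chartHom_C]
    · simp [coe_chartHom_X]
  constructor
  · have hle : chart A (t : K) ≤ ((chart A (t : K)).subtype.comp (chartHom A t y hy)).range := by
      refine Subring.closure_le.2 ?_
      rintro x (hx | ⟨b, hb, rfl⟩)
      · exact ⟨Polynomial.C ⟨x, hx⟩, by simp [chartHom_C]⟩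
      · obtain ⟨p, q, rfl⟩ := Ideal.mem_span_pair.1 (hm ▸ hb)
        refine ⟨Polynomial.C p + Polynomial.C q * X, ?_⟩
        rw [hcoe]
        simp
        field_simp
    rintro ⟨x, hx⟩
    obtain ⟨g, hg⟩ := hle hx
    exact ⟨g, Subtype.ext hg⟩
  · refine le_antisymm (fun g hg => ?_) ?_
    · rw [Ideal.mem_span_singleton]
      refine C_mul_X_sub_C_dvd_of_eval₂_eq_zero A.toSubring.subtype Subtype.coe_injective ht hty g ?_
      have := congrArg (· g) (congrArg DFunLike.coe hcoe)
      simp only [RingHom.comp_apply, RingHom.mem_ker.1 hg, map_zero] at this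
      exact this.symm
    · rw [Ideal.span_le, Set.singleton_subset_iff, SetLike.mem_coe, RingHom.mem_ker]
      apply Subtype.ext
      rw [map_sub, map_mul, chartHom_C, chartHom_C]
      have h : (t : K) * (chartHom A t y hy X : chart A (t : K)) - y = 0 := by
        rw [coe_chartHom_X, mul_div_cancel₀ _ ht0, sub_self]
      exact h

theorem inclusion_dvd_of_mem {t : A.toSubring} (ht0 : t ≠ 0) {b : A.toSubring}
    (hb : b ∈ maximalIdeal A.toSubring) :
    Subring.inclusion (le_chart A t) t ∣ Subring.inclusion (le_chart A t) b := by
  have ht0 : (t : K) ≠ 0 := fun h => ht0 (Subtype.ext h)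
  exact ⟨⟨_, div_mem_chart hb⟩, Subtype.ext (mul_div_cancel₀ _ ht0).symm⟩

theorem extend_eq_map {A B : Subring K} (h : A ≤ B) (I : Ideal A) :
    extend A B I = I.map (Subring.inclusion h) := by
  rw [extend, Ideal.map]
  congr 1
  ext b
  constructor
  · rintro ⟨a, ha, hab⟩
    exact ⟨a, ha, Subtype.ext hab⟩
  · rintro ⟨a, ha, rfl⟩
    exact ⟨a, ha, rfl⟩

theorem extend_eq_span_singleton {A B : Subring K} (h : A ≤ B) {I : Ideal A} {t : A} (ht : t ∈ I)
    (hI : ∀ a ∈ I, Subring.inclusion h t ∣ Subring.inclusion h a) :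
    extend A B I = Ideal.span {Subring.inclusion h t} := by
  rw [extend_eq_map h]
  refine le_antisymm ?_ ?_
  · rw [Ideal.map_le_iff_le_comap]
    exact fun a ha => Ideal.mem_span_singleton.2 (hI a ha)
  · rw [Ideal.span_le, Set.singleton_subset_iff]
    exact Ideal.mem_map_of_mem _ ht

theorem exceptionalIdeal_eq_span {t : A.toSubring} (ht : t ∈ maximalIdeal A.toSubring)
    (ht0 : t ≠ 0) :
    exceptionalIdeal A (t : K) = Ideal.span {Subring.inclusion (le_chart A t) t} :=
  extend_eq_span_singleton (le_chart A t) ht fun _ ha => inclusion_dvd_of_mem ht0 ha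

/-- If `t ∈ 𝔪²`, then `t² ∣ t` in the chart, so `t` is a unit there and the chart misses the
exceptional divisor. Charts that meet it thus come from a parameter `t`. -/
theorem notMem_sq_of_exceptionalIdeal_ne_top {t : A.toSubring} (ht : t ∈ maximalIdeal A.toSubring)
    (ht0 : t ≠ 0) (h : exceptionalIdeal A (t : K) ≠ ⊤) : t ∉ maximalIdeal A.toSubring ^ 2 := by
  intro ht2
  set s := Subring.inclusion (le_chart A t) t with hs
  have hs0 : s ≠ 0 := fun h => ht0 (Subtype.ext (congrArg Subtype.val h :))
  have key : ∀ b ∈ maximalIdeal A.toSubring ^ 2, s ^ 2 ∣ Subring.inclusion (le_chart A t) b := by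
    intro b hb
    rw [sq] at hb
    refine Submodule.mul_induction_on hb (fun p hp q hq => ?_) fun p q hp hq => ?_
    · rw [map_mul, sq]
      exact mul_dvd_mul (inclusion_dvd_of_mem ht0 hp) (inclusion_dvd_of_mem ht0 hq)
    · rw [map_add]
      exact dvd_add hp hq
  obtain ⟨c, hc⟩ := key t ht2
  refine h ((exceptionalIdeal_eq_span ht ht0).trans (Ideal.span_singleton_eq_top.2 ?_))
  refine IsUnit.of_mul_eq_one c (mul_left_cancel₀ hs0 ?_)
  rw [mul_one, ← mul_assoc, ← sq, ← hc]

end Chart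

/-! ### Points of smooth surfaces and of their blow-ups -/

section RegularPoint

variable [Algebra ℂ K]

/-- The properties of the local ring of a point of a smooth surface that are inherited by the
points of its blow-up. -/
structure IsRegularPoint (A : LocalSubring K) : Prop where
  isNoetherianRing : IsNoetherianRing A.toSubring
  exists_span : ∃ u v, maximalIdeal A.toSubring = Ideal.span {u, v}
  two_le_height : 2 ≤ (maximalIdeal A.toSubring).height
  const_mem : ∀ c : ℂ, algebraMap ℂ K c ∈ A.toSubring
  residue : ∀ a : A.toSubring, ∃ c : ℂ,
    a - ⟨algebraMap ℂ K c, const_mem c⟩ ∈ maximalIdeal A.toSubring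

theorem IsSmoothSurfaceGerm.isRegularPoint {A : LocalSubring K} (h : IsSmoothSurfaceGerm A) :
    IsRegularPoint A := by
  have := h.isRegular
  refine ⟨inferInstance, ?_, ?_, h.const_mem, h.residue⟩
  · have hr : (maximalIdeal A.toSubring).spanFinrank = 2 := by
      have := IsRegularLocalRing.spanFinrank_maximalIdeal (R := A.toSubring)
      rw [h.dim_eq_two] at this
      exact_mod_cast this
    have hfg : (maximalIdeal A.toSubring).FG := IsNoetherian.noetherian _
    obtain ⟨s, hs, hspan⟩ : ∃ s : Set A.toSubring, s.ncard = 2 ∧ Ideal.span s = maximalIdeal _ :=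
      ⟨_, by rw [Submodule.FG.generators_ncard hfg, hr], Submodule.span_generators _⟩
    obtain ⟨u, v, -, rfl⟩ := Set.ncard_eq_two.1 hs
    exact ⟨u, v, hspan.symm⟩
  · have := IsLocalRing.maximalIdeal_height_eq_ringKrullDim (R := A.toSubring)
    rw [h.dim_eq_two] at this
    exact WithBot.coe_le_coe.1 this.ge

theorem IsRegularPoint.isAlgClosed {A : LocalSubring K} (h : IsRegularPoint A) :
    IsAlgClosed (ResidueField A.toSubring) := by
  set f : ℂ →+* ResidueField A.toSubring := (IsLocalRing.residue A.toSubring).comp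
    ((algebraMap ℂ K).codRestrict A.toSubring h.const_mem)
  have hf : Function.Surjective f := by
    intro x
    obtain ⟨a, rfl⟩ := residue_surjective x
    obtain ⟨c, hc⟩ := h.residue a
    rw [← residue_eq_zero_iff, map_sub, sub_eq_zero] at hc
    exact ⟨c, hc.symm⟩
  set e := RingEquiv.ofBijective f ⟨f.injective, hf⟩
  refine IsAlgClosed.of_exists_root _ fun p _ hp => ?_
  obtain ⟨r, hr⟩ := IsAlgClosed.exists_root (p.map (e.symm : _ →+* ℂ)) <| by
    rw [Polynomial.degree_map]
    exact (Polynomial.degree_pos_of_irreducible hp).ne'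
  refine ⟨e r, ?_⟩
  have := congrArg e (hr : _ = _)
  rwa [map_zero, Polynomial.eval_map, ← RingEquiv.coe_toRingHom, Polynomial.hom_eval₂,
    show (e : ℂ →+* _).comp (e.symm : _ →+* ℂ) = RingHom.id _ from
      RingHom.ext fun x => e.apply_symm_apply x, Polynomial.eval₂_id] at this

end RegularPoint

section Points

open Polynomial

variable [Algebra ℂ K] {A : LocalSubring K}

theorem IsRegularPoint.exists_isChart (hA : IsRegularPoint A) {t : A.toSubring}
    (ht : t ∈ maximalIdeal A.toSubring) (ht0 : t ≠ 0) (htop : exceptionalIdeal A (t : K) ≠ ⊤) :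
    ∃ (y : A.toSubring) (hy : y ∈ maximalIdeal A.toSubring),
      maximalIdeal A.toSubring = Ideal.span {t, y} ∧ IsChart t y (chartHom A t y hy) := by
  have := hA.isNoetherianRing
  obtain ⟨u, v, huv⟩ := hA.exists_span
  obtain ⟨y, hm⟩ := exists_span_pair_of_notMem_sq huv ht
    (notMem_sq_of_exceptionalIdeal_ne_top ht ht0 htop)
  have hy : y ∈ maximalIdeal A.toSubring := hm ▸ Ideal.subset_span (by simp)
  refine ⟨y, hy, hm, isChart_chartHom hm (prime_of_span_pair hm hA.two_le_height) ?_ hy⟩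
  simpa using not_dvd_pow_of_span_pair hm hA.two_le_height 1

/-- The equation `t` of the exceptional divisor at a point of the blow-up, and the relation between
the multiplicities of a curve and of its strict transform. -/
theorem IsPointOfBlowUp.exists_equation {B : LocalSubring K} (hA : IsRegularPoint A)
    (h : IsPointOfBlowUp A B) : IsRegularPoint B ∧ ∃ t ∈ maximalIdeal A.toSubring,
      Prime (Subring.inclusion h.le t) ∧
      Subring.inclusion h.le t ∉ maximalIdeal B.toSubring ^ 2 ∧
      (∀ a ∈ maximalIdeal A.toSubring, Subring.inclusion h.le t ∣ Subring.inclusion h.le a) ∧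
      ∀ k, ∀ f ∈ maximalIdeal A.toSubring ^ k, f ∉ maximalIdeal A.toSubring ^ (k + 1) →
        ∃ f' : B.toSubring, Subring.inclusion h.le f = Subring.inclusion h.le t ^ k * f' ∧
          ¬ Subring.inclusion h.le t ∣ f' ∧ f' ∉ maximalIdeal B.toSubring ^ (k + 1) := by
  have hle := h.le
  obtain ⟨t, ht, ht0, P, hP, hexc, rfl⟩ := h
  have := hA.isNoetherianRing
  have := hA.isAlgClosed
  have htop : exceptionalIdeal A (t : K) ≠ ⊤ := fun h => hP.ne_top (top_le_iff.1 (h ▸ hexc))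
  obtain ⟨y, hy, hm, he⟩ := hA.exists_isChart ht ht0 htop
  obtain ⟨π, hsurj, hπ, hker⟩ := he.exists_reduction hm
  rw [exceptionalIdeal_eq_span ht ht0, Ideal.span_le, Set.singleton_subset_iff, SetLike.mem_coe,
    ← chartHom_C t y hy] at hexc
  obtain ⟨c, hc⟩ := IsChart.exists_center hsurj hker hexc
  set B := LocalSubring.ofPrime (chart A (t : K)) P
  have hincl : ∀ a : A.toSubring, algebraMap (chart A (t : K)) B.toSubring
      (chartHom A t y hy (Polynomial.C a)) = Subring.inclusion hle a := by
    intro a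
    rw [chartHom_C]
    rfl
  have : IsNoetherianRing (chart A (t : K)) := isNoetherianRing_of_surjective _ _ _ he.surjective
  have hBN : IsNoetherianRing B.toSubring := IsLocalization.isNoetherianRing P.primeCompl _ this
  have hmB := IsChart.maximalIdeal_eq_span_of_center (B := B.toSubring) hsurj hπ hker hexc hc
  have hB2 : 2 ≤ (maximalIdeal B.toSubring).height := by
    refine IsChart.two_le_height hπ hker ?_ hexc hc
    rw [chartHom_C]
    exact fun h => ht0 (Subtype.ext (congrArg Subtype.val h :))
  have hmAB : ∀ a ∈ maximalIdeal A.toSubring,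
      Subring.inclusion hle t ∣ Subring.inclusion hle a := fun a ha => by
    rw [← hincl, ← hincl]
    exact map_dvd _ (he.map_C_mem hm ha)
  have htB : Subring.inclusion hle t ∈ maximalIdeal B.toSubring := by
    rw [hmB, hincl]
    exact Ideal.subset_span (by simp)
  refine ⟨⟨hBN, ⟨_, _, hmB⟩, hB2, fun c => hle (hA.const_mem c), fun b => ?_⟩, t, ht, ?_, ?_, hmAB,
    fun k f hf hf' => ?_⟩
  · obtain ⟨a, ha⟩ := IsChart.exists_sub_map_C_mem_maximalIdeal (B := B.toSubring) hπ hc b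
    obtain ⟨c, hc⟩ := hA.residue a
    refine ⟨c, ?_⟩
    rw [hincl] at ha
    -- The constant approximates `a` modulo `𝔪_A`, and the image of `𝔪_A` lies in `(t) ⊆ 𝔪_B`.
    have := add_mem ha (Ideal.mem_of_dvd _ (hmAB _ hc) htB)
    rw [map_sub, sub_add_sub_cancel] at this
    exact this
  · rw [← hincl]
    exact prime_of_span_pair hmB hB2
  · rw [← hincl]
    exact notMem_sq_of_span_pair hmB hB2
  · obtain ⟨f', hff', h0, hdeg⟩ := he.exists_strict hm hπ hf hf'
    refine ⟨algebraMap _ _ f', ?_, ?_, IsChart.algebraMap_notMem_pow hc h0 hdeg⟩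
    · rw [← hincl, hff', map_mul, map_pow, hincl]
    · rw [← hincl]
      exact IsChart.not_dvd_algebraMap hker hexc h0

/-- The exceptional ideal `(t)` is the kernel of the reduction to a polynomial ring, hence prime and
its own only minimal prime. So `V` is the chart localized at `(t)`, where whatever has nonzero
reduction becomes a unit. -/
theorem IsExceptionalDivisor.exists_equation {V : LocalSubring K} (hA : IsRegularPoint A)
    (h : IsExceptionalDivisor A V) : ∃ t ∈ maximalIdeal A.toSubring, t ≠ 0 ∧
      maximalIdeal V.toSubring = Ideal.span {Subring.inclusion h.le t} ∧
      (∀ a ∈ maximalIdeal A.toSubring, Subring.inclusion h.le t ∣ Subring.inclusion h.le a) ∧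
      ∀ k, ∀ f ∈ maximalIdeal A.toSubring ^ k, f ∉ maximalIdeal A.toSubring ^ (k + 1) →
        ∃ f' : V.toSubring, Subring.inclusion h.le f = Subring.inclusion h.le t ^ k * f' ∧
          IsUnit f' := by
  have hle := h.le
  obtain ⟨t, ht, ht0, P, hP, hexc, rfl⟩ := h
  have htop : exceptionalIdeal A (t : K) ≠ ⊤ :=
    fun h => hP.ne_top (top_le_iff.1 (h ▸ hexc.1.2))
  obtain ⟨y, hy, hm, he⟩ := hA.exists_isChart ht ht0 htop
  obtain ⟨π, hsurj, hπ, hker⟩ := he.exists_reduction hm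
  have hspan : RingHom.ker π = exceptionalIdeal A (t : K) := by
    ext x
    rw [RingHom.mem_ker, hker, exceptionalIdeal_eq_span ht ht0, Ideal.mem_span_singleton,
      chartHom_C]
  have hP' : P = exceptionalIdeal A (t : K) := by
    have : (exceptionalIdeal A (t : K)).IsPrime := hspan ▸ RingHom.ker_isPrime π
    rwa [Ideal.minimalPrimes_eq_subsingleton_self] at hexc
  set V := LocalSubring.ofPrime (chart A (t : K)) P
  have hincl : ∀ a : A.toSubring, algebraMap (chart A (t : K)) V.toSubring
      (chartHom A t y hy (Polynomial.C a)) = Subring.inclusion hle a := by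
    intro a
    rw [chartHom_C]
    rfl
  have hmAV : ∀ a ∈ maximalIdeal A.toSubring,
      Subring.inclusion hle t ∣ Subring.inclusion hle a := fun a ha => by
    rw [← hincl, ← hincl]
    exact map_dvd _ (he.map_C_mem hm ha)
  refine ⟨t, ht, ht0, ?_, hmAV, fun k f hf hf' => ?_⟩
  · refine (IsLocalization.AtPrime.map_eq_maximalIdeal P V.toSubring).symm.trans ?_
    refine (congrArg (Ideal.map (algebraMap (chart A (t : K)) V.toSubring))
      (hP'.trans (exceptionalIdeal_eq_span ht ht0))).trans ?_
    rw [Ideal.map_span, Set.image_singleton, ← hincl, chartHom_C]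
  · obtain ⟨f', hff', h0, -⟩ := he.exists_strict hm hπ hf hf'
    refine ⟨algebraMap _ _ f', ?_, ?_⟩
    · rw [← hincl, hff', map_mul, map_pow, hincl]
    · refine IsLocalization.map_units V.toSubring (⟨f', fun h => h0 ?_⟩ : P.primeCompl)
      rwa [← RingHom.mem_ker, hspan, ← hP']

/-- `B` is the local ring of a point, closed or not, lying on the exceptional divisor of the
blow-up of the closed point of `Spec A`. -/
def IsLocalRingOfBlowUp (A B : LocalSubring K) : Prop :=
  ∃ t ∈ maximalIdeal A.toSubring, t ≠ 0 ∧
    ∃ (P : Ideal (chart A (t : K))) (_ : P.IsPrime),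
      exceptionalIdeal A (t : K) ≤ P ∧ B = LocalSubring.ofPrime (chart A (t : K)) P

omit [Algebra ℂ K] in
theorem IsPointOfBlowUp.isLocalRingOfBlowUp {B : LocalSubring K} (h : IsPointOfBlowUp A B) :
    IsLocalRingOfBlowUp A B := by
  obtain ⟨t, ht, ht0, P, hP, hexc, rfl⟩ := h
  exact ⟨t, ht, ht0, P, hP.isPrime, hexc, rfl⟩

omit [Algebra ℂ K] in
theorem IsExceptionalDivisor.isLocalRingOfBlowUp {V : LocalSubring K}
    (h : IsExceptionalDivisor A V) : IsLocalRingOfBlowUp A V := by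
  obtain ⟨t, ht, ht0, P, hP, hexc, rfl⟩ := h
  exact ⟨t, ht, ht0, P, hP, hexc.1.2, rfl⟩

/-- Extension of derivations, seen as sections of square-zero extensions, to a point of the
blow-up. -/
theorem IsLocalRingOfBlowUp.exists_lift {B : LocalSubring K} (hA : IsRegularPoint A)
    (h : IsLocalRingOfBlowUp A B) (hle : A.toSubring ≤ B.toSubring) :
    ∃ t ∈ maximalIdeal A.toSubring, ∃ (y : A.toSubring) (z : B.toSubring), t ≠ 0 ∧
      (∀ a ∈ maximalIdeal A.toSubring, Subring.inclusion hle t ∣ Subring.inclusion hle a) ∧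
      ∀ {V T : Type u} [CommRing V] [AddCommGroup T] [Module V T] [Module Vᵐᵒᵖ T]
        [IsCentralScalar V T] (j : B.toSubring →+* V) (φ : A.toSubring →+* TrivSqZeroExt V T)
        (_ : ∀ a, (φ a).fst = j (Subring.inclusion hle a)) (τ : T)
        (_ : j (Subring.inclusion hle t) • τ + j z • (φ t).snd = (φ y).snd),
        ∃ φ' : B.toSubring →+* TrivSqZeroExt V T, (∀ a, φ' (Subring.inclusion hle a) = φ a) ∧
          (∀ b, (φ' b).fst = j b) ∧ (φ' z).snd = τ := by
  obtain ⟨t, ht, ht0, P, hP, hexc, rfl⟩ := h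
  have htop : exceptionalIdeal A (t : K) ≠ ⊤ := fun h => hP.ne_top (top_le_iff.1 (h ▸ hexc))
  obtain ⟨y, hy, hm, he⟩ := hA.exists_isChart ht ht0 htop
  set B := LocalSubring.ofPrime (chart A (t : K)) P
  have hincl : ∀ a : A.toSubring, algebraMap (chart A (t : K)) B.toSubring
      (chartHom A t y hy (Polynomial.C a)) = Subring.inclusion hle a := by
    intro a
    rw [chartHom_C]
    rfl
  refine ⟨t, ht, y, algebraMap (chart A (t : K)) B.toSubring (chartHom A t y hy X), ht0,
    fun a ha => ?_, ?_⟩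
  · rw [← hincl, ← hincl]
    exact map_dvd _ (he.map_C_mem hm ha)
  · intro V T _ _ _ _ _ j φ hφ τ hτ
    obtain ⟨φ₁, h₁, h₁', h₁X⟩ := he.exists_lift_trivSqZeroExt
      (j.comp (algebraMap (chart A (t : K)) B.toSubring)) φ
      (fun r => by rw [hφ, RingHom.comp_apply, hincl]) τ
      (by rw [RingHom.comp_apply, RingHom.comp_apply, hincl]; exact hτ)
    obtain ⟨φ₂, h₂, h₂'⟩ := exists_lift_trivSqZeroExt_of_isLocalization P.primeCompl j φ₁ h₁'
    exact ⟨φ₂, fun a => by rw [← hincl, h₂, h₁], h₂', by rw [h₂, h₁X]⟩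

end Points

/-! ### Divisors reached by successive blow-ups of points -/

/-- The order along `V` of the pull-back of the maximal ideal of `A`, as a length over `V`. -/
noncomputable def exceptionalLength (A V : LocalSubring K) : ℕ∞ :=
  Module.length V.toSubring
    (V.toSubring ⧸ extend A.toSubring V.toSubring (maximalIdeal A.toSubring))

theorem exceptionalLength_eq_ord {A V : LocalSubring K} (h : A.toSubring ≤ V.toSubring)
    {t : A.toSubring} (ht : t ∈ maximalIdeal A.toSubring)
    (hdvd : ∀ a ∈ maximalIdeal A.toSubring, Subring.inclusion h t ∣ Subring.inclusion h a) :
    exceptionalLength A V = Ring.ord V.toSubring (Subring.inclusion h t) := by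
  rw [exceptionalLength, extend_eq_span_singleton h ht hdvd, Ring.ord]

/-- `V` is the local ring of a prime divisor obtained by a sequence of blow-ups of points, the
first of which has the local ring `A`; `s` is the sum of the orders along `V` of the maximal ideals
of the points blown up. -/
inductive DivisorOver (V : LocalSubring K) : LocalSubring K → ℕ∞ → Prop
  | exceptional {A : LocalSubring K} (h : IsExceptionalDivisor A V) :
      DivisorOver V A (exceptionalLength A V)
  | blowUp {A B : LocalSubring K} {s : ℕ∞} (h : IsPointOfBlowUp A B) (hB : DivisorOver V B s) :
      DivisorOver V A (exceptionalLength A V + s)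

theorem DivisorOver.le {A V : LocalSubring K} {s : ℕ∞} (h : DivisorOver V A s) :
    A.toSubring ≤ V.toSubring := by
  induction h with
  | exceptional h => exact h.le
  | blowUp h _ ih => exact h.le.trans ih

theorem dvd_inclusion_of_le {A B V : LocalSubring K} (hAB : A.toSubring ≤ B.toSubring)
    (hBV : B.toSubring ≤ V.toSubring) {t a : A.toSubring}
    (h : Subring.inclusion hAB t ∣ Subring.inclusion hAB a) :
    Subring.inclusion (hAB.trans hBV) t ∣ Subring.inclusion (hAB.trans hBV) a :=
  map_dvd (Subring.inclusion hBV) h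

theorem inclusion_ne_zero {A B : Subring K} (h : A ≤ B) {t : A} (ht : t ≠ 0) :
    Subring.inclusion h t ≠ 0 :=
  (map_ne_zero_iff _ (Subring.inclusion_injective h)).2 ht

/-! ### Lower bound for the discrepancy -/

section Discrepancy

/-- Every derivation of `B` with values in the `V`-module `T` extends to `V`. -/
def ExtendsDerivations (B V : LocalSubring K) (h : B.toSubring ≤ V.toSubring) (T : Type u)
    [AddCommGroup T] [Module V.toSubring T] [Module V.toSubringᵐᵒᵖ T]
    [IsCentralScalar V.toSubring T] : Prop :=
  ∀ φ : B.toSubring →+* TrivSqZeroExt V.toSubring T,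
    (∀ b, (φ b).fst = Subring.inclusion h b) →
      ∃ φ' : V.toSubring →+* TrivSqZeroExt V.toSubring T,
        (∀ b, φ' (Subring.inclusion h b) = φ b) ∧ ∀ v, (φ' v).fst = v

variable [Algebra ℂ K] {A B V : LocalSubring K} {T : Type u} [AddCommGroup T]
  [Module V.toSubring T] [Module V.toSubringᵐᵒᵖ T] [IsCentralScalar V.toSubring T]

/-- Divisibility of `T` solves `t τ = D y - z D t` for the derivative `τ` of `z = y/t`, which
extends the derivation to `B`. -/
theorem ExtendsDerivations.of_isLocalRingOfBlowUp (hA : IsRegularPoint A)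
    (h : IsLocalRingOfBlowUp A B) (hAB : A.toSubring ≤ B.toSubring)
    (hBV : B.toSubring ≤ V.toSubring)
    (hdiv : ∀ v : V.toSubring, v ≠ 0 → ∀ τ : T, ∃ τ' : T, v • τ' = τ)
    (hB : ExtendsDerivations B V hBV T) : ExtendsDerivations A V (hAB.trans hBV) T := by
  intro φ hφ
  obtain ⟨t, ht, y, z, ht0, -, hlift⟩ := h.exists_lift hA hAB
  obtain ⟨τ, hτ⟩ := hdiv _ (inclusion_ne_zero (hAB.trans hBV) ht0)
    ((φ y).snd - Subring.inclusion hBV z • (φ t).snd)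
  obtain ⟨φ₁, h₁, h₁', -⟩ := hlift (Subring.inclusion hBV) φ hφ τ
    (by rw [eq_sub_iff_add_eq] at hτ; exact hτ)
  obtain ⟨φ₂, h₂, h₂'⟩ := hB φ₁ h₁'
  exact ⟨φ₂, fun a => (h₂ (Subring.inclusion hAB a)).trans (h₁ a), h₂'⟩

/-- The zero derivation of `A` extends to `B` with `D z = τ` whenever `t τ = 0`. With the
annihilator of `τ` equal to `(t)`, the extension to `V` shows that `dz` generates a submodule of
length at least that of `V/(t)` in the kernel of `Ω[V⁄A] → Ω[V⁄B]`. -/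
theorem exceptionalLength_add_discrepancy_le (hA : IsRegularPoint A)
    (h : IsLocalRingOfBlowUp A B) (hAB : A.toSubring ≤ B.toSubring)
    (hBV : B.toSubring ≤ V.toSubring)
    (htors : ∀ v : V.toSubring, v ≠ 0 → ∃ τ : T, ∀ r : V.toSubring, r • τ = 0 ↔ v ∣ r)
    (hB : ExtendsDerivations B V hBV T) :
    exceptionalLength A V + discrepancy B V hBV ≤ discrepancy A V (hAB.trans hBV) := by
  obtain ⟨t, ht, y, z, ht0, hdvd, hlift⟩ := h.exists_lift hA hAB
  obtain ⟨τ, hτ⟩ := htors _ (inclusion_ne_zero (hAB.trans hBV) ht0)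
  obtain ⟨φ₁, h₁, h₁', h₁z⟩ := hlift (Subring.inclusion hBV)
    ((TrivSqZeroExt.inlHom V.toSubring T).comp (Subring.inclusion (hAB.trans hBV)))
    (fun a => rfl) τ (by
      change Subring.inclusion hBV (Subring.inclusion hAB t) • τ +
        Subring.inclusion hBV z • (0 : T) = 0
      rw [smul_zero, add_zero]
      exact (hτ _).2 dvd_rfl)
  obtain ⟨φ₂, h₂, h₂'⟩ := hB φ₁ h₁'
  rw [exceptionalLength_eq_ord (hAB.trans hBV) ht fun a ha => dvd_inclusion_of_le hAB hBV (hdvd a ha)]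
  let : Algebra A.toSubring B.toSubring := (Subring.inclusion hAB).toAlgebra
  let : Algebra B.toSubring V.toSubring := (Subring.inclusion hBV).toAlgebra
  let : Algebra A.toSubring V.toSubring := (Subring.inclusion (hAB.trans hBV)).toAlgebra
  have : IsScalarTower A.toSubring B.toSubring V.toSubring := .of_algebraMap_eq fun _ => rfl
  let : Module A.toSubring T := Module.compHom T (Subring.inclusion (hAB.trans hBV))
  have : IsScalarTower A.toSubring V.toSubring T := ⟨fun a v m => mul_smul _ _ _⟩
  refine length_quotient_add_length_kaehlerDifferential_le (T := T)
    (derivationOfTrivSqZeroExt φ₂ h₂' fun a => ?_) z (Subring.inclusion (hAB.trans hBV) t) fun r hr => ?_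
  · have : φ₂ (Subring.inclusion hBV (Subring.inclusion hAB a)) = _ := (h₂ _).trans (h₁ a)
    exact congrArg TrivSqZeroExt.snd this
  · refine (hτ r).1 ?_
    have h : (φ₂ (Subring.inclusion hBV z)).snd = τ := by rw [h₂, h₁z]
    rw [← h]
    exact hr

/-- The two claims share one induction: the bound at a point needs the extension property at the
next one. -/
theorem DivisorOver.extendsDerivations_and_le_discrepancy {s : ℕ∞} (h : DivisorOver V A s)
    (hA : IsRegularPoint A)
    (hdiv : ∀ v : V.toSubring, v ≠ 0 → ∀ τ : T, ∃ τ' : T, v • τ' = τ)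
    (htors : ∀ v : V.toSubring, v ≠ 0 → ∃ τ : T, ∀ r : V.toSubring, r • τ = 0 ↔ v ∣ r) :
    ExtendsDerivations A V h.le T ∧ s ≤ discrepancy A V h.le := by
  induction h with
  | exceptional h =>
    have hV : ExtendsDerivations V V le_rfl T := fun φ hφ => ⟨φ, fun b => rfl, hφ⟩
    exact ⟨.of_isLocalRingOfBlowUp hA h.isLocalRingOfBlowUp h.le le_rfl hdiv hV,
      le_self_add.trans (exceptionalLength_add_discrepancy_le hA h.isLocalRingOfBlowUp h.le le_rfl
        htors hV)⟩
  | blowUp h hB ih =>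
    obtain ⟨hB₁, hB₂⟩ := ih (h.exists_equation hA).1
    exact ⟨.of_isLocalRingOfBlowUp hA h.isLocalRingOfBlowUp h.le hB.le hdiv hB₁,
      (add_le_add_right hB₂ _).trans (exceptionalLength_add_discrepancy_le hA h.isLocalRingOfBlowUp
        h.le hB.le htors hB₁)⟩

end Discrepancy

/-- The discrepancy is at least the sum of the orders of the maximal ideals of the points blown
up. -/
theorem DivisorOver.le_discrepancy [Algebra ℂ K] {A V : LocalSubring K} {s : ℕ∞} (h : DivisorOver V A s) (hA : IsRegularPoint A) :
    s ≤ discrepancy A V h.le := by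
  -- The test module is `K/V`: it is divisible, and the class of `1/v` has annihilator `(v)`.
  let L : Submodule V.toSubring K := LinearMap.range (Algebra.linearMap V.toSubring K)
  have hdiv : ∀ v : V.toSubring, v ≠ 0 → ∀ τ : K ⧸ L, ∃ τ' : K ⧸ L, v • τ' = τ := by
    intro v hv τ
    have hv : (v : K) ≠ 0 := fun h => hv (Subtype.ext h)
    obtain ⟨k, rfl⟩ := L.mkQ_surjective τ
    refine ⟨L.mkQ (k / v), ?_⟩
    rw [← map_smul]
    exact congrArg L.mkQ (mul_div_cancel₀ k hv)
  have htors : ∀ v : V.toSubring, v ≠ 0 → ∃ τ : K ⧸ L, ∀ r : V.toSubring, r • τ = 0 ↔ v ∣ r := by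
    intro v hv
    have hv : (v : K) ≠ 0 := fun h => hv (Subtype.ext h)
    refine ⟨L.mkQ (1 / v), fun r => ?_⟩
    rw [← map_smul, Submodule.mkQ_apply, Submodule.Quotient.mk_eq_zero]
    constructor
    · rintro ⟨w, hw⟩
      have hw : (w : K) = r * (1 / v) := hw
      refine ⟨w, Subtype.ext ?_⟩
      change (r : K) = v * w
      rw [hw]
      field_simp
    · rintro ⟨w, rfl⟩
      refine ⟨w, ?_⟩
      change (w : K) = v * w * (1 / v)
      field_simp
  let : Module V.toSubringᵐᵒᵖ (K ⧸ L) :=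
    Module.compHom _ (RingEquiv.toOpposite V.toSubring).symm.toRingHom
  have : IsCentralScalar V.toSubring (K ⧸ L) := ⟨fun v m => rfl⟩
  exact (h.extendsDerivations_and_le_discrepancy hA hdiv htors).2

/-! ### Orders along the divisor and strict transforms -/

section Order

variable [Algebra ℂ K] {A B V : LocalSubring K}

theorem exists_mem_pow_notMem_pow_succ {R : Type*} [CommRing R] {I : Ideal R} {f : R} {k : ℕ}
    (hf : f ∉ I ^ (k + 1)) : ∃ j ≤ k, f ∈ I ^ j ∧ f ∉ I ^ (j + 1) := by
  induction k with
  | zero => exact ⟨0, le_rfl, by simp, hf⟩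
  | succ k ih =>
    by_cases h : f ∈ I ^ (k + 1)
    · exact ⟨k + 1, le_rfl, h, hf⟩
    · obtain ⟨j, hj, h⟩ := ih h
      exact ⟨j, hj.trans k.le_succ, h⟩

/-- Induction along the chain: if `f` has order `j` and `f = t^j f'`, then `f'` has order `i ≤ j` at
the next point. The factor `t^j` contributes `j` times the order of `𝔪_A`, and `f'` at most `j`
times the remaining sum. -/
theorem DivisorOver.ord_le {s : ℕ∞} (h : DivisorOver V A s) (hA : IsRegularPoint A)
    {f : A.toSubring} {k : ℕ} (hf : f ∉ maximalIdeal A.toSubring ^ (k + 1)) :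
    Ring.ord V.toSubring (Subring.inclusion h.le f) ≤ k * s := by
  obtain ⟨j, hj, hfj, hfj'⟩ := exists_mem_pow_notMem_pow_succ hf
  refine le_trans ?_ (mul_le_mul_left (Nat.cast_le.2 hj) s)
  clear hf hj
  induction h generalizing j with
  | exceptional h =>
    obtain ⟨t, ht, ht0, -, hdvd, hstr⟩ := h.exists_equation hA
    obtain ⟨f', hff', hu⟩ := hstr j f hfj hfj'
    have ht0 := mem_nonZeroDivisors_of_ne_zero (inclusion_ne_zero h.le ht0)
    rw [hff', Ring.ord_mul_of_isUnit_right hu, Ring.ord_pow ht0, nsmul_eq_mul,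
      exceptionalLength_eq_ord h.le ht hdvd]
  | blowUp h hB ih =>
    obtain ⟨hBreg, t, ht, htp, -, hdvd, hstr⟩ := h.exists_equation hA
    obtain ⟨f', hff', -, hf'⟩ := hstr j f hfj hfj'
    obtain ⟨i, hi, hfi, hfi'⟩ := exists_mem_pow_notMem_pow_succ hf'
    have ht0 := mem_nonZeroDivisors_of_ne_zero (inclusion_ne_zero hB.le htp.ne_zero)
    have hff' : Subring.inclusion (h.le.trans hB.le) f =
        Subring.inclusion hB.le (Subring.inclusion h.le t) ^ j * Subring.inclusion hB.le f' := by
      rw [← map_pow, ← map_mul, ← hff']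
      rfl
    rw [hff', Ring.ord_mul' _ (pow_mem ht0 j), Ring.ord_pow ht0, nsmul_eq_mul, mul_add,
      exceptionalLength_eq_ord (h.le.trans hB.le) ht
        fun a ha => dvd_inclusion_of_le h.le hB.le (hdvd a ha)]
    refine add_le_add le_rfl ((ih hBreg i hfi hfi').trans ?_)
    gcongr

end Order

theorem le_order {A : LocalSubring K} {I : Ideal A.toSubring} {k : ℕ}
    (h : I ≤ maximalIdeal A.toSubring ^ k) : (k : ℕ∞) ≤ order A I :=
  le_iSup₂_of_le k h le_rfl

theorem orderAlong_span_singleton_le {A V : LocalSubring K} (h : A.toSubring ≤ V.toSubring)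
    {p : V.toSubring} (hp : p ≠ 0) (hV : maximalIdeal V.toSubring = Ideal.span {p})
    (f : A.toSubring) :
    orderAlong A V (Ideal.span {f}) ≤ Ring.ord V.toSubring (Subring.inclusion h f) := by
  refine iSup₂_le fun k hk => ?_
  have hf : Subring.inclusion h f ∈ maximalIdeal V.toSubring ^ k := by
    refine hk ?_
    rw [extend_eq_map h]
    exact Ideal.mem_map_of_mem _ (Ideal.mem_span_singleton_self f)
  rw [hV, Ideal.span_singleton_pow, Ideal.mem_span_singleton] at hf
  refine le_trans ?_ (Ring.ord_le_ord_of_dvd hf)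
  rw [Ring.ord_pow (mem_nonZeroDivisors_of_ne_zero hp), nsmul_eq_mul]
  refine le_mul_of_one_le_right (by simp) ?_
  rw [Order.one_le_iff_pos, Ring.ord, Module.length_pos_iff, ← hV]
  exact Ideal.Quotient.nontrivial_iff.2 (Ideal.IsPrime.ne_top inferInstance)

/-- If `b t^j` is a multiple of `t^k f'`, then it is a multiple of `f'`; the prime `t` does not
divide `f'`, so the powers of `t` cancel and `f' ∣ b`. -/
theorem strictTransform_span_singleton_le {A B : LocalSubring K} (h : A.toSubring ≤ B.toSubring)
    {t : A.toSubring} (ht : t ∈ maximalIdeal A.toSubring) (htp : Prime (Subring.inclusion h t))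
    (hdvd : ∀ a ∈ maximalIdeal A.toSubring, Subring.inclusion h t ∣ Subring.inclusion h a)
    {f : A.toSubring} {f' : B.toSubring} {k : ℕ}
    (hf : Subring.inclusion h f = Subring.inclusion h t ^ k * f')
    (hf' : ¬ Subring.inclusion h t ∣ f') :
    strictTransform A B (Ideal.span {f}) ≤ Ideal.span {f'} := by
  refine iSup_le fun j b hb => ?_
  rw [extend_eq_span_singleton h ht hdvd, Ideal.span_singleton_pow, extend_eq_map h, Ideal.map_span,
    Set.image_singleton, hf] at hb
  have hb := Submodule.mem_colon.1 hb _ (Ideal.mem_span_singleton_self _)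
  rw [smul_eq_mul, Ideal.mem_span_singleton] at hb
  rw [Ideal.mem_span_singleton]
  generalize Subring.inclusion h t = p at *
  have h1 : f' ∣ b * p ^ j := (dvd_mul_left f' (p ^ k)).trans hb
  obtain ⟨c, hc⟩ := h1
  have h2 : p ^ j ∣ c := by
    refine htp.pow_dvd_of_dvd_mul_left j hf' ⟨b, ?_⟩
    rw [← hc, mul_comm]
  obtain ⟨d, rfl⟩ := h2
  refine ⟨d, mul_right_cancel₀ (pow_ne_zero j htp.ne_zero) ?_⟩
  rw [hc]
  ring

theorem IsExceptionalDivisor.exceptionalLength_eq_one [Algebra ℂ K] {A V : LocalSubring K}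
    (hA : IsRegularPoint A) (h : IsExceptionalDivisor A V) : exceptionalLength A V = 1 := by
  obtain ⟨t, ht, -, hV, hdvd, -⟩ := h.exists_equation hA
  rw [exceptionalLength, extend_eq_span_singleton h.le ht hdvd, ← hV, Module.length_eq_one_iff,
    isSimpleModule_iff_isCoatom]
  exact (maximalIdeal.isMaximal V.toSubring).out

theorem IsBlowUpChain.exists_divisorOver {N : ℕ} {x : ℕ → LocalSubring K} (hx : IsBlowUpChain N x)
    {V : LocalSubring K} (k j : ℕ) (hN : j + k < N) (hV : IsExceptionalDivisor (x (j + k)) V) :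
    ∃ s, DivisorOver V (x j) s := by
  induction k generalizing j with
  | zero => exact ⟨_, .exceptional hV⟩
  | succ k ih =>
    obtain ⟨s, hs⟩ := ih (j + 1) (by omega) (by rwa [show j + 1 + k = j + (k + 1) by omega])
    exact ⟨_, .blowUp (hx j (by omega)) hs⟩

theorem IsBlowUpChain.isRegularPoint [Algebra ℂ K] {N : ℕ} {x : ℕ → LocalSubring K}
    (hx : IsBlowUpChain N x) (h0 : IsRegularPoint (x 0)) : ∀ i, i < N → IsRegularPoint (x i)
  | 0, _ => h0
  | i + 1, hi => ((hx i hi).exists_equation (hx.isRegularPoint h0 i (by omega))).1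

/-- Chebyshev's inequality: `(k - l) (s - a) ≥ 0` gives `2 (k a + l s) ≤ (k + l) (a + s)`. Infinite
`s` or `n` would make the left side of the strict inequality infinite, and `k + l ≤ 2n` makes `k`
and `l` finite. -/
theorem two_mul_lt_of_lt {n k l a s : ℕ∞} (hn : 1 ≤ n) (hlk : l ≤ k) (has : a ≤ s)
    (h : n * (a + s + 1) < k * a + l * s) : 2 * n < k + l := by
  by_contra! hkl
  have hs : s ≠ ⊤ := by
    rintro rfl
    rw [add_top, top_add, ENat.mul_top (by rintro rfl; simp at hn)] at h
    exact not_top_lt h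
  have hn' : n ≠ ⊤ := by
    rintro rfl
    rw [ENat.top_mul (by simp)] at h
    exact not_top_lt h
  lift s to ℕ using hs
  lift n to ℕ using hn'
  lift a to ℕ using ne_top_of_le_ne_top (ENat.natCast_ne_top s) has
  have hkl' : k + l ≠ ⊤ := ne_top_of_le_ne_top (by exact_mod_cast ENat.natCast_ne_top (2 * n)) hkl
  lift k to ℕ using fun h => hkl' (by simp [h])
  lift l to ℕ using fun h => hkl' (by simp [h])
  norm_cast at *
  nlinarith [Nat.mul_le_mul hlk has, mul_le_mul_of_nonneg_left hkl (Nat.zero_le s),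
    mul_le_mul_of_nonneg_left hkl (Nat.zero_le a)]

end SurfaceGerm

/-! ### The inequality for the multiplicities -/

theorem proposition9 {K : Type*} [Field K] [Algebra ℂ K]
    -- the chain of blow-ups of the points `x_0 = x, x_1, …, x_{N-1}`, over the germ `x ∈ S`
    (N : ℕ) (x : ℕ → LocalSubring K)
    (hS : SurfaceGerm.IsSmoothSurfaceGerm (x 0)) (hx : SurfaceGerm.IsBlowUpChain N x)
    -- the effective curve germ `C` with local equation `f`, passing through `x`
    (f : (x 0).toSubring) (hf0 : f ≠ 0) (hfx : f ∈ IsLocalRing.maximalIdeal (x 0).toSubring)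
    (C : Ideal (x 0).toSubring) (hC : C = Ideal.span {f})
    (n : ℕ) (hn : 1 ≤ n)
    -- the log Noether-Fano inequality holds for an exceptional divisor `E_{i+1}`, `i + 1 ≤ N`
    (i : ℕ) (hi : i < N) (V : LocalSubring K)
    (hV : SurfaceGerm.IsExceptionalDivisor (x i) V)
    (hNF : (n : ℕ∞) * (SurfaceGerm.discrepancy (x 0) V (hx.le_exceptional hi hV) + 1) <
      SurfaceGerm.orderAlong (x 0) V C) :
    2 * (n : ℕ∞) < SurfaceGerm.mult x C 1 ∨
      (2 ≤ N ∧ 2 * (n : ℕ∞) < SurfaceGerm.mult x C 1 + SurfaceGerm.mult x C 2) := by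

  have h0 := hS.isRegularPoint
  have := h0.isNoetherianRing
  subst hC
  obtain ⟨k, hfk, hfk'⟩ : ∃ k, f ∈ IsLocalRing.maximalIdeal (x 0).toSubring ^ k ∧
      f ∉ IsLocalRing.maximalIdeal (x 0).toSubring ^ (k + 1) := by
    -- Krull's intersection theorem: a nonzero `f` has finite order.
    have : ∃ m, f ∉ IsLocalRing.maximalIdeal (x 0).toSubring ^ (m + 1) := by
      by_contra! h
      refine hf0 ?_
      rw [← Ideal.mem_bot, ← Ideal.iInf_pow_eq_bot_of_isLocalRing
        (IsLocalRing.maximalIdeal (x 0).toSubring) (Ideal.IsPrime.ne_top inferInstance),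
        Ideal.mem_iInf]
      exact fun m => Ideal.pow_le_pow_right m.le_succ (h m)
    obtain ⟨m, hm⟩ := this
    obtain ⟨j, -, hj⟩ := SurfaceGerm.exists_mem_pow_notMem_pow_succ hm
    exact ⟨j, hj⟩
  have hmult1 : (k : ℕ∞) ≤ SurfaceGerm.mult x (Ideal.span {f}) 1 :=
    SurfaceGerm.le_order ((Ideal.span_singleton_le_iff_mem _).2 hfk)
  have hle := hx.le_exceptional hi hV
  have hord : SurfaceGerm.orderAlong (x 0) V (Ideal.span {f}) ≤
      Ring.ord V.toSubring (Subring.inclusion hle f) := by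
    obtain ⟨p, -, hp0, hp, -⟩ := hV.exists_equation (hx.isRegularPoint h0 i hi)
    exact SurfaceGerm.orderAlong_span_singleton_le hle (SurfaceGerm.inclusion_ne_zero hV.le hp0) hp f
  have hNF := hNF.trans_le hord
  rcases i with _ | i
  -- Here `E = E_1`, the order of `𝔪` along `E` is 1, and `2n ≤ n (a_E + 1) < k`.
  · left
    have hD := SurfaceGerm.DivisorOver.exceptional hV
    have ha := hV.exceptionalLength_eq_one h0
    have h1 := ha.ge.trans (hD.le_discrepancy h0)
    have h2 := (hD.ord_le h0 hfk').trans_eq (by rw [ha, mul_one])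
    refine lt_of_le_of_lt ?_ (hNF.trans_le (h2.trans hmult1))
    rw [mul_comm, ← one_add_one_eq_two]
    gcongr
  · right
    refine ⟨by omega, ?_⟩
    -- The first blow-up is split off: `s` sums over the centres from `x_1` on.
    obtain ⟨s, hs⟩ := hx.exists_divisorOver i 1 (by omega) (by rwa [add_comm 1 i])
    have hpt := hx 0 (by omega)
    obtain ⟨h1, t, ht, htp, ht2, hdvd, hstr⟩ := hpt.exists_equation h0
    obtain ⟨f', hff', hndvd, hf'⟩ := hstr k f hfk hfk'
    obtain ⟨l, hlk, hl, hl'⟩ := SurfaceGerm.exists_mem_pow_notMem_pow_succ hf'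
    have hmult2 : (l : ℕ∞) ≤ SurfaceGerm.mult x (Ideal.span {f}) 2 :=
      SurfaceGerm.le_order <| (SurfaceGerm.strictTransform_span_singleton_le hpt.le ht htp hdvd hff'
        hndvd).trans ((Ideal.span_singleton_le_iff_mem _).2 hl)
    have ha := SurfaceGerm.exceptionalLength_eq_ord (hpt.le.trans hs.le) ht
      fun a ha => SurfaceGerm.dvd_inclusion_of_le hpt.le hs.le (hdvd a ha)
    -- As `E_1` is smooth at `x_1`, its equation `t` is not in the square of the maximal ideal
    -- there, so `DivisorOver.ord_le` applies to `t` with `k = 1`.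
    have has : SurfaceGerm.exceptionalLength (x 0) V ≤ s := by
      refine ha.trans_le ((hs.ord_le h1 (k := 1) ht2).trans ?_)
      rw [Nat.cast_one, one_mul]
    have hdisc := (SurfaceGerm.DivisorOver.blowUp hpt hs).le_discrepancy h0
    have hfV : Subring.inclusion hle f = Subring.inclusion (hpt.le.trans hs.le) t ^ k *
        Subring.inclusion hs.le f' := congrArg (Subring.inclusion hs.le) hff'
    have hbound : Ring.ord V.toSubring (Subring.inclusion hle f) ≤
        k * SurfaceGerm.exceptionalLength (x 0) V + l * s := by
      have ht0 : Subring.inclusion (hpt.le.trans hs.le) t ∈ nonZeroDivisors V.toSubring :=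
        mem_nonZeroDivisors_of_ne_zero (SurfaceGerm.inclusion_ne_zero hs.le htp.ne_zero)
      rw [hfV, Ring.ord_mul' _ (pow_mem ht0 k), Ring.ord_pow ht0, nsmul_eq_mul, ha]
      exact add_le_add le_rfl (hs.ord_le h1 hl')
    refine (SurfaceGerm.two_mul_lt_of_lt (by exact_mod_cast hn) (by exact_mod_cast hlk) has
      (lt_of_le_of_lt ?_ (hNF.trans_le hbound))).trans_le (add_le_add hmult1 hmult2)
    gcongr
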